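/- Let $d\ge 2$ and let $F=(F_1,\dots,F_d):\mathbb{R}^d\to\mathbb{R}^d$ be an infinitely differentiable vector field whose components belong to the Schwartz class $\mathcal{S}(\mathbb{R}^d)$. **Notation.** Let $G(x)=\frac1{2\pi}\ln|x|$ for $d=2$ and $G(x)=-\frac{\Gamma(d/2-1)}{4\pi^{d/2}}|x|^{2-d}$ for $d\ge3$ (the fundamental solution of the Laplace equation). Let $\Phi=\operatorname{div}F$, $\varphi=\Phi*G$, $F^{\mathrm p}=\nabla\varphi$, $F^{\mathrm s}=F-F^{\mathrm p}$, and let $\Psi=(\Psi_1,\dots,\Psi_d)$ with $\Psi_j=\Delta F^{\mathrm s}_j$. For $\omega\in\mathbb{S}^{d-1}$ and $p\in\mathbb{R}$ let $[\mathcal{R}f](\omega,p)$ be the integral of $f$ over the hyperplane $\Pi(\omega,p)=\{x:\omega\cdot x=p\}$ with respect to its area element, and let $\mathfrak{R}$ be $\mathcal R$ applied to each component of a vector field. For every $\omega\in\mathbb{S}^{d-1}$ extend $\omega$ in an arbitrary way to an orthonormal basis $(\omega,\omega_1,\dots,\omega_{d-1})$ of $\mathbb{R}^d$, $\omega_k=\omega_k(\omega)$,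 and put $$[\mathcal{D}^{\shortparallel}_kF](\omega,p)=\int_{\Pi(\omega,p)}\omega_k\cdot F(x)\,dA(x),\qquad [\mathcal{W}^{\shortparallel}_1F](\omega,p)=\int_{\Pi(\omega,p)}(\omega_1\cdot x)\,(\omega_1\cdot F(x))\,dA(x).$$ For a real number $\alpha<d$ put $$\mathcal{R}^{-1}g=\tfrac12(2\pi)^{1-d}\,I^{-\alpha}\mathcal{R}^{\#}I^{\alpha-d+1}g,\qquad [\mathcal{R}^{\#}h](x)=\int_{\mathbb{S}^{d-1}}h(\omega,\omega\cdot x)\,d\omega,\qquad I^{\beta}u=\mathcal{F}^{-1}\big(|\xi|^{-\beta}\,\mathcal{F}u\big),$$ where $\xi$ is the angular frequency, the Fourier transform $\mathcal{F}u$ is understood in the sense of tempered distributions and is a function, and $I^{\alpha-d+1}$ acts on $g(\omega,p)$ in the variable $p$. **Theorem.** The potential $\varphi$ is well defined and smooth, all the integrals over hyperplanes and all the convolutions below converge absolutely, all the derivatives in $p$ below exist, and the following holds. 1. For all $(\omega,p)\in\mathbb{S}^{d-1}\times\mathbb{R}$, $$[\mathfrak{R}\Psi](\omega,p)=\frac{\partial^2}{\partial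 p^2}\sum_{j=1}^{d-1}\omega_j\,[\mathcal{D}^{\shortparallel}_jF](\omega,p).$$ 2. For every $\alpha<d$, $j=1,\dots,d$ and $x\in\mathbb{R}^d$, the expression $\mathcal{R}^{-1}(e_j\cdot\mathfrak{R}\Psi)$ is well defined and $\Psi_j(x)=[\mathcal{R}^{-1}(e_j\cdot\mathfrak{R}\Psi)](x)$. 3. For every $\alpha<d$ and $x\in\mathbb{R}^d$, the right-hand side below is well defined and $$\Phi(x)=\Big[\mathcal{R}^{-1}\Big\{\mathcal{R}\big((x\cdot\omega_1)\,(\omega_1\cdot\Psi(x))\big)-\frac{\partial^2}{\partial p^2}\mathcal{W}^{\shortparallel}_1F\Big\}\Big](x).$$ 4. For every $x\in\mathbb{R}^d$, $$F(x)=(\Phi*\nabla G)(x)+\sum_{j=1}^d e_j\,(\Psi_j*G)(x).$$ -/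

import Mathlib

open MeasureTheory
open scoped SchwartzMap FourierTransform Convolution

/-- Euclidean space `ℝ^d`. -/
abbrev Space (d : ℕ) : Type := EuclideanSpace ℝ (Fin d)

/-- The unit sphere `S^{d-1}` of `ℝ^d`. -/
abbrev USphere (d : ℕ) : Type := Metric.sphere (0 : Space d) 1

/-- A choice, for every unit vector `ω`, of vectors `ω_1, …, ω_{d-1}` (here `w ω 0, w ω 1, …`) such
that `(ω, ω_1, …, ω_{d-1})` is orthonormal, hence an orthonormal basis of `ℝ^d`. No regularity in
`ω` is required. -/
def IsAdaptedFrame {d : ℕ} (w : USphere d → Fin (d - 1) → Space d) : Prop :=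
  ∀ ω : USphere d, Orthonormal ℝ (w ω) ∧ ∀ k, inner ℝ (ω : Space d) (w ω k) = 0

section Radon

variable {d : ℕ}

/-- Integrability of `f` over the hyperplane `{x | ω · x = p}`. The hyperplane is parametrized
isometrically by `y ↦ p ω + y`, with `y` in the orthogonal complement of `ω`. -/
def RadonIntegrable {M : Type*} [NormedAddCommGroup M] (f : Space d → M)
    (ω : USphere d) (p : ℝ) : Prop :=
  Integrable (fun y : (Submodule.span ℝ {(ω : Space d)})ᗮ => f (p • (ω : Space d) + (y : Space d)))

/-- The Radon transform: the integral of `f` over the hyperplane `{x | ω · x = p}` with respect to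
the Euclidean `(d-1)`-dimensional area. -/
noncomputable def radon (f : Space d → ℝ) (ω : USphere d) (p : ℝ) : ℝ :=
  ∫ y : (Submodule.span ℝ {(ω : Space d)})ᗮ, f (p • (ω : Space d) + (y : Space d))

/-- The componentwise Radon transform of a vector field. -/
noncomputable def vecRadon (F : Space d → Space d) (ω : USphere d) (p : ℝ) : Space d :=
  WithLp.toLp 2 fun j => radon (fun x => F x j) ω p

/-- The longitudinal Radon transform `D_k^∥ F`. -/
noncomputable def longRadon (w : USphere d → Fin (d - 1) → Space d) (k : Fin (d - 1))
    (F : Space d → Space d) (ω : USphere d) (p : ℝ) : ℝ :=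
  radon (fun x => inner ℝ (w ω k) (F x)) ω p

/-- The linearly weighted longitudinal Radon transform `W_k^∥ F`. -/
noncomputable def weightedLongRadon (w : USphere d → Fin (d - 1) → Space d) (k : Fin (d - 1))
    (F : Space d → Space d) (ω : USphere d) (p : ℝ) : ℝ :=
  radon (fun x => inner ℝ (w ω k) x * inner ℝ (w ω k) (F x)) ω p

end Radon

section Riesz

variable {V : Type*} [NormedAddCommGroup V] [InnerProductSpace ℝ V] [FiniteDimensional ℝ V]
  [MeasurableSpace V] [BorelSpace V]

/-- The function `uhat` is the Fourier transform of the function `u` in the sense of tempered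
distributions (normalization `∫ e^{-2πi⟨x,η⟩} u(x) dx`). -/
def IsFourierTransform (u uhat : V → ℂ) : Prop :=
  ∀ φ : 𝓢(V, ℂ), Integrable (fun x => u x * φ x) ∧ Integrable (fun η => uhat η * φ η) ∧
    ∫ x, u x * 𝓕 (φ : V → ℂ) x = ∫ η, uhat η * φ η

/-- `v = I^β u`, the Riesz potential of order `β` of `u`: `v` is the inverse Fourier transform of
`|ξ|^{-β}` times the Fourier transform of `u`, the latter being a function and the product being
integrable. As `η` is the ordinary frequency, the angular frequency is `ξ = 2πη`. -/
def HasRieszPotential (β : ℝ) (u v : V → ℂ) : Prop :=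
  ∃ uhat : V → ℂ, IsFourierTransform u uhat ∧
    Integrable (fun η : V => (((2 * Real.pi * ‖η‖) ^ (-β) : ℝ) : ℂ) * uhat η) ∧
    ∀ x, v x = 𝓕⁻ (fun η : V => (((2 * Real.pi * ‖η‖) ^ (-β) : ℝ) : ℂ) * uhat η) x

end Riesz

/-- `f = ½ (2π)^{1-d} I^{-α} R^# I^{α-d+1} g`, every expression being well defined: the inner Riesz
potential `h` acts in the variable `p`, and `R^#` integrates `h(ω, ω·x)` over the unit sphere with
respect to its surface measure. -/
def HasRadonInverse {d : ℕ} (α : ℝ) (g : USphere d → ℝ → ℝ) (f : Space d → ℝ) : Prop :=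
  ∃ (h : USphere d → ℝ → ℂ) (v : Space d → ℂ),
    (∀ ω, HasRieszPotential (α - d + 1) (fun p => (g ω p : ℂ)) (h ω)) ∧
    (∀ x : Space d, Integrable (fun ω : USphere d => h ω (inner ℝ (ω : Space d) x))
      (volume : Measure (Space d)).toSphere) ∧
    HasRieszPotential (-α)
      (fun x : Space d => ∫ ω : USphere d, h ω (inner ℝ (ω : Space d) x)
        ∂(volume : Measure (Space d)).toSphere) v ∧
    ∀ x, (f x : ℂ) = 1 / 2 * (((2 * Real.pi) ^ (1 - d : ℝ) : ℝ) : ℂ) * v x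

/-- The Riesz potential is unique, so `HasRieszPotential β` is the graph of a partially defined
operator. -/
theorem HasRieszPotential.unique {V : Type*} [NormedAddCommGroup V] [InnerProductSpace ℝ V]
    [FiniteDimensional ℝ V] [MeasurableSpace V] [BorelSpace V] {β : ℝ} {u v v' : V → ℂ}
    (h : HasRieszPotential β u v) (h' : HasRieszPotential β u v') : v = v' := by
  obtain ⟨a, ha, -, hv⟩ := h
  obtain ⟨b, hb, -, hv'⟩ := h'
  have key : ∀ c : V → ℂ, IsFourierTransform u c → LocallyIntegrable c := by
    intro c hc
    rw [locallyIntegrable_iff]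
    intro K hK
    obtain ⟨R, hR, hKR⟩ := hK.isBounded.subset_ball_lt 0 0
    let f : ContDiffBump (0 : V) := ⟨R, R + 1, hR, by linarith⟩
    have h1 : HasCompactSupport (fun x => (f x : ℂ)) :=
      f.hasCompactSupport.comp_left (g := fun r : ℝ => (r : ℂ)) (by simp)
    have h2 : ContDiff ℝ (⊤ : ℕ∞) (fun x => (f x : ℂ)) :=
      Complex.ofRealCLM.contDiff.comp f.contDiff
    refine ((hc (h1.toSchwartzMap h2)).2.1.integrableOn (s := K)).congr_fun ?_
      hK.isClosed.measurableSet
    intro x hx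
    have : f x = 1 := f.one_of_mem_closedBall (Metric.ball_subset_closedBall (hKR hx))
    simp [this]
  have hab : a =ᵐ[volume] b := by
    refine ae_eq_of_integral_contDiff_smul_eq (key a ha) (key b hb) ?_
    intro g hg hgc
    have h1 : HasCompactSupport (fun x => (g x : ℂ)) :=
      hgc.comp_left (g := fun r : ℝ => (r : ℂ)) (by simp)
    have h2 : ContDiff ℝ (⊤ : ℕ∞) (fun x => (g x : ℂ)) :=
      Complex.ofRealCLM.contDiff.comp hg
    have := (ha (h1.toSchwartzMap h2)).2.2.symm.trans (hb (h1.toSchwartzMap h2)).2.2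
    simpa [mul_comm] using this
  funext x
  rw [hv, hv', Real.fourierInv_eq, Real.fourierInv_eq]
  refine integral_congr_ae ?_
  filter_upwards [hab] with y hy
  rw [hy]

/-- The filtered backprojection of given data is unique. -/
theorem HasRadonInverse.unique {d : ℕ} {α : ℝ} {g : USphere d → ℝ → ℝ} {f f' : Space d → ℝ}
    (h : HasRadonInverse α g f) (h' : HasRadonInverse α g f') : f = f' := by
  obtain ⟨k, v, hk, -, hv, hf⟩ := h
  obtain ⟨k', v', hk', -, hv', hf'⟩ := h'
  obtain rfl : k = k' := funext fun ω => (hk ω).unique (hk' ω)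
  obtain rfl : v = v' := hv.unique hv'
  funext x
  exact_mod_cast (hf x).trans (hf' x).symm

section Helmholtz

variable {d : ℕ}

/-- The fundamental solution `G` of the Laplace equation in `ℝ^d`, `d ≥ 2`. -/
noncomputable def fundSol (d : ℕ) (x : Space d) : ℝ :=
  if d = 2 then 1 / (2 * Real.pi) * Real.log ‖x‖
  else -(Real.Gamma (d / 2 - 1) / (4 * Real.pi ^ (d / 2 : ℝ))) * ‖x‖ ^ (2 - d : ℝ)

/-- The divergence `Φ` of a vector field. -/
noncomputable def divergence (F : Space d → Space d) (x : Space d) : ℝ :=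
  ∑ i, fderiv ℝ (fun z => F z i) x (EuclideanSpace.single i 1)

/-- The potential `φ = Φ * G`. -/
noncomputable def potential (F : Space d → Space d) : Space d → ℝ :=
  divergence F ⋆[ContinuousLinearMap.lsmul ℝ ℝ, volume] fundSol d

/-- The potential part `∇φ` of a vector field. -/
noncomputable def potentialPart (F : Space d → Space d) (x : Space d) : Space d :=
  gradient (potential F) x

/-- The solenoidal part `F - ∇φ` of a vector field. -/
noncomputable def solenoidalPart (F : Space d → Space d) (x : Space d) : Space d :=
  F x - potentialPart F x

/-- The componentwise Laplacian `Ψ` of the solenoidal part of a vector field. -/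
noncomputable def lapSolenoidal (F : Space d → Space d) (x : Space d) : Space d :=
  WithLp.toLp 2 fun j => Laplacian.laplacian (fun z => solenoidalPart F z j) x

end Helmholtz

/-! Convolution with `fundSol` inverts the Laplacian on Schwartz functions, so Δ∂_jφ = ∂_jΦ and Ψ_j
= ΔF_j - ∂_jΦ. Hence Ψ is a Schwartz field, and the Radon calculus can be done on Schwartz
functions.

The Radon transform sends ∂_v f to (ω·v) ∂_p Rf: derivatives along the hyperplane integrate to zero
and normal ones become p-derivatives (`SchwartzMap.radon_lineDeriv`). So RΨ_j = ∂_p²(RF_j - ω_j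
ω·RF), and the bracket is component j of the projection of RF to the complement of ω, which is the
frame sum of longitudinal transforms.

For Φ, take v = ω_1. Then v·Ψ = Δ(v·F) - ∂_vΦ. Multiplying by v·x and moving this factor inside the
derivatives leaves Δ((v·x)(v·F)), the term Φ, and v-derivatives, which the transform kills. Thus the
data in the third claim are exactly RΦ (`SchwartzMap.radon_innerMul_innerConst_lapSolField`).

Both reconstructions then follow from filtered backprojection (`SchwartzMap.hasRadonInverse`), that
is, the Fourier slice theorem in polar coordinates. Finally Φ*∇G = ∇φ and Ψ_j*G = F_j - ∂_jφ add up
to F.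

The equation ΔG = δ is used only against Schwartz functions
(`IsLaplaceProfile.integral_mul_laplacian`). One derivative is moved onto G by smoothing the norm;
the other is integrated along rays from the origin. -/

/-! ### Polar coordinates and decay of Schwartz functions. -/

section Polar

open Set Metric

theorem integrableOn_rpow_mul_inv_one_add_pow {β : ℝ} (hβ : -1 < β) {N : ℕ} (hN : β + 1 < N) :
    IntegrableOn (fun r : ℝ => r ^ β * ((1 + r) ^ N)⁻¹) (Ioi 0) := by
  have hmeas : Measurable (fun r : ℝ => r ^ β * ((1 + r) ^ N)⁻¹) := by fun_prop
  rw [← Ioc_union_Ioi_eq_Ioi (zero_le_one' ℝ)]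
  refine IntegrableOn.union ?_ ?_
  · have h : IntegrableOn (fun r : ℝ => r ^ β) (Ioc 0 1) :=
      (intervalIntegrable_iff_integrableOn_Ioc_of_le zero_le_one).1
        (intervalIntegral.intervalIntegrable_rpow' hβ)
    refine h.mono' hmeas.aestronglyMeasurable ?_
    filter_upwards [ae_restrict_mem measurableSet_Ioc] with r hr
    have hr0 : 0 < r := hr.1
    rw [Real.norm_of_nonneg (by positivity)]
    exact mul_le_of_le_one_right (by positivity)
      (inv_le_one_of_one_le₀ (one_le_pow₀ (by linarith)))
  · have h : IntegrableOn (fun r : ℝ => r ^ (β - N)) (Ioi 1) :=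
      integrableOn_Ioi_rpow_of_lt (by linarith) one_pos
    refine h.mono' hmeas.aestronglyMeasurable ?_
    filter_upwards [ae_restrict_mem measurableSet_Ioi] with r hr
    have hr0 : 0 < r := one_pos.trans hr
    rw [Real.norm_of_nonneg (by positivity), Real.rpow_sub hr0, Real.rpow_natCast, div_eq_mul_inv]
    gcongr
    linarith

theorem SchwartzMap.exists_norm_le_inv_one_add_pow {V E : Type*} [NormedAddCommGroup V]
    [NormedSpace ℝ V] [NormedAddCommGroup E] [NormedSpace ℝ E] (f : 𝓢(V, E)) (N : ℕ) :
    ∃ C, 0 ≤ C ∧ ∀ x, ‖f x‖ ≤ C * ((1 + ‖x‖) ^ N)⁻¹ := by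
  refine ⟨2 ^ N * (Finset.Iic (N, 0)).sup (fun m => SchwartzMap.seminorm ℝ m.1 m.2) f,
    mul_nonneg (by positivity) (apply_nonneg _ _), fun x => ?_⟩
  have := SchwartzMap.one_add_le_sup_seminorm_apply (𝕜 := ℝ) (m := (N, 0)) le_rfl le_rfl f x
  rw [norm_iteratedFDeriv_zero] at this
  rw [← div_eq_mul_inv, le_div_iff₀ (by positivity), mul_comm]
  exact this

/-- Peetre's inequality: 1 + ‖t‖ ≤ (1 + ‖x‖)(1 + ‖x - t‖). It turns decay in x - t into decay in t,
locally uniformly in x. -/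
theorem inv_one_add_norm_sub_pow_le {V : Type*} [NormedAddCommGroup V] (x t : V) (N : ℕ) :
    ((1 + ‖x - t‖) ^ N)⁻¹ ≤ (1 + ‖x‖) ^ N * ((1 + ‖t‖) ^ N)⁻¹ := by
  rw [← div_eq_mul_inv, le_div_iff₀ (by positivity), inv_mul_le_iff₀ (by positivity), ← mul_pow]
  refine pow_le_pow_left₀ (by positivity) ?_ N
  have := norm_sub_norm_le t x
  rw [norm_sub_rev] at this
  nlinarith [norm_nonneg x, norm_nonneg t, norm_nonneg (x - t),
    mul_nonneg (norm_nonneg x) (norm_nonneg (x - t))]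

variable {V : Type*} [NormedAddCommGroup V] [InnerProductSpace ℝ V] [FiniteDimensional ℝ V]
  [MeasurableSpace V] [BorelSpace V] {E : Type*} [NormedAddCommGroup E] [NormedSpace ℝ E]

theorem integrable_norm_rpow_mul_inv_one_add_pow [Nontrivial V] {β : ℝ}
    (hβ : -(Module.finrank ℝ V : ℝ) < β) {N : ℕ} (hN : β + Module.finrank ℝ V < N) :
    Integrable (fun x : V => ‖x‖ ^ β * ((1 + ‖x‖) ^ N)⁻¹) := by
  have hd : 1 ≤ Module.finrank ℝ V := Module.finrank_pos
  rw [integrable_fun_norm_addHaar volume (f := fun r : ℝ => r ^ β * ((1 + r) ^ N)⁻¹)]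
  refine (integrableOn_rpow_mul_inv_one_add_pow (β := β + Module.finrank ℝ V - 1) (N := N)
    (by linarith) (by linarith)).congr_fun ?_ measurableSet_Ioi
  intro r (hr : 0 < r)
  simp only [smul_eq_mul]
  rw [← mul_assoc, ← Real.rpow_natCast r (_ - 1), ← Real.rpow_add hr, Nat.cast_sub hd]
  congr 2
  push_cast
  ring

theorem SchwartzMap.integrable_norm_rpow_smul [Nontrivial V] (f : 𝓢(V, E)) {β : ℝ}
    (hβ : -(Module.finrank ℝ V : ℝ) < β) : Integrable (fun x : V => ‖x‖ ^ β • f x) := by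
  obtain ⟨N, hN⟩ := exists_nat_gt (β + Module.finrank ℝ V)
  obtain ⟨C, -, hf⟩ := f.exists_norm_le_inv_one_add_pow N
  have hm : AEStronglyMeasurable (fun x : V => ‖x‖ ^ β • f x) :=
    (by fun_prop : Measurable fun x : V => ‖x‖ ^ β).aestronglyMeasurable.smul
      f.continuous.aestronglyMeasurable
  refine ((integrable_norm_rpow_mul_inv_one_add_pow hβ hN).const_mul C).mono' hm
    (ae_of_all _ fun x => ?_)
  rw [norm_smul, Real.norm_of_nonneg (by positivity)]
  calc ‖x‖ ^ β * ‖f x‖ ≤ ‖x‖ ^ β * (C * ((1 + ‖x‖) ^ N)⁻¹) := by gcongr; exact hf x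
    _ = _ := by ring

theorem integrable_polar {E : Type*} [NormedAddCommGroup E] {f : V → E} (hf : Integrable f) :
    Integrable (fun q : sphere (0 : V) 1 × Ioi (0 : ℝ) => f ((q.2 : ℝ) • (q.1 : V)))
      ((volume : Measure V).toSphere.prod (Measure.volumeIoiPow (Module.finrank ℝ V - 1))) := by
  have h := (volume : Measure V).measurePreserving_homeomorphUnitSphereProd.integrable_comp_emb
    (g := fun q : sphere (0 : V) 1 × Ioi (0 : ℝ) => f ((q.2 : ℝ) • (q.1 : V)))
    (Homeomorph.measurableEmbedding _)
  rw [← h]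
  have h2 : ((fun q : sphere (0 : V) 1 × Ioi (0 : ℝ) => f ((q.2 : ℝ) • (q.1 : V))) ∘
      homeomorphUnitSphereProd V) = f ∘ Subtype.val := by
    ext x
    have hx : ‖(x : V)‖ ≠ 0 := norm_ne_zero_iff.2 x.2
    simp [smul_smul, hx]
  rw [h2, ← integrableOn_iff_comap_subtypeVal (measurableSet_singleton _).compl]
  exact hf.integrableOn

theorem integral_polar_prod [Nontrivial V] (f : V → E) :
    ∫ x, f x = ∫ q : sphere (0 : V) 1 × Ioi (0 : ℝ), f ((q.2 : ℝ) • (q.1 : V))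
      ∂((volume : Measure V).toSphere.prod (Measure.volumeIoiPow (Module.finrank ℝ V - 1))) := by
  rw [← (volume : Measure V).measurePreserving_homeomorphUnitSphereProd.integral_comp
    (Homeomorph.measurableEmbedding _)]
  have h := integral_subtype_comap (μ := (volume : Measure V))
    (measurableSet_singleton (0 : V)).compl f
  rw [restrict_compl_singleton] at h
  rw [← h]
  congr 1
  ext x
  have hx : ‖(x : V)‖ ≠ 0 := norm_ne_zero_iff.2 x.2
  simp [smul_smul, hx]

theorem integral_volumeIoiPow (n : ℕ) (f : ℝ → E) :
    ∫ r : Ioi (0 : ℝ), f r ∂(Measure.volumeIoiPow n) = ∫ r in Ioi (0 : ℝ), r ^ n • f r := by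
  simp only [Measure.volumeIoiPow, ENNReal.ofReal]
  rw [integral_withDensity_eq_integral_smul,
    integral_subtype_comap measurableSet_Ioi fun a => Real.toNNReal (a ^ n) • f a,
    setIntegral_congr_fun measurableSet_Ioi fun x hx => ?_]
  · rw [NNReal.smul_def, Real.coe_toNNReal _ (pow_nonneg hx.out.le _)]
  · exact (measurable_subtype_coe.pow_const _).real_toNNReal

theorem integral_polar [Nontrivial V] {f : V → E} (hf : Integrable f) :
    ∫ x, f x = ∫ ω : sphere (0 : V) 1, (∫ r in Ioi (0 : ℝ),
      r ^ (Module.finrank ℝ V - 1) • f (r • (ω : V))) ∂(volume : Measure V).toSphere := by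
  rw [integral_polar_prod, integral_prod _ (integrable_polar hf)]
  congr 1
  ext ω
  exact integral_volumeIoiPow _ (fun r => f (r • (ω : V)))

end Polar

/-! ### Convolution of Schwartz functions with kernels of moderate growth. -/

section SlowGrowth

variable {V : Type*} [NormedAddCommGroup V] [InnerProductSpace ℝ V] [FiniteDimensional ℝ V]
  [MeasurableSpace V] [BorelSpace V]
  {E E' W : Type*} [NormedAddCommGroup E] [NormedSpace ℝ E]
  [NormedAddCommGroup E'] [NormedSpace ℝ E'] [NormedAddCommGroup W] [NormedSpace ℝ W]

/-- A kernel that becomes integrable after division by some power of `1 + ‖t‖`. -/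
def IntegrableUpToGrowth {E : Type*} [NormedAddCommGroup E] [NormedSpace ℝ E] (K : V → E) : Prop :=
  ∃ N : ℕ, Integrable (fun t : V => ((1 + ‖t‖) ^ N)⁻¹ • K t)

theorem IntegrableUpToGrowth.aestronglyMeasurable {K : V → E} (hK : IntegrableUpToGrowth K) :
    AEStronglyMeasurable K := by
  obtain ⟨N, hN⟩ := hK
  have h : Measurable fun t : V => (1 + ‖t‖) ^ N := by fun_prop
  refine (h.aestronglyMeasurable.smul hN.aestronglyMeasurable).congr (ae_of_all _ fun t => ?_)
  have : (1 + ‖t‖) ^ N ≠ 0 := by positivity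
  simp [smul_smul, this]

/-- One bound serves both G and ∇G: the negative power is the singularity of ∇G, and the linear term
absorbs growth at infinity, such as that of the logarithm. -/
theorem IntegrableUpToGrowth.of_norm_le [Nontrivial V] {K : V → E} (hm : AEStronglyMeasurable K)
    {C : ℝ} (hK : ∀ t ≠ 0, ‖K t‖ ≤ C * (‖t‖ ^ (1 - Module.finrank ℝ V : ℝ) + ‖t‖)) :
    IntegrableUpToGrowth K := by
  refine ⟨Module.finrank ℝ V + 2, ?_⟩
  have h1 := integrable_norm_rpow_mul_inv_one_add_pow (V := V)
    (β := 1 - Module.finrank ℝ V) (N := Module.finrank ℝ V + 2) (by linarith) (by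
      push_cast; linarith [(Nat.cast_nonneg (Module.finrank ℝ V) : (0 : ℝ) ≤ _)])
  have h2 := integrable_norm_rpow_mul_inv_one_add_pow (V := V)
    (β := 1) (N := Module.finrank ℝ V + 2)
    (by linarith [(Nat.cast_nonneg (Module.finrank ℝ V) : (0 : ℝ) ≤ _)]) (by push_cast; linarith)
  have h : Measurable fun t : V => ((1 + ‖t‖) ^ (Module.finrank ℝ V + 2))⁻¹ := by fun_prop
  refine ((h1.add h2).const_mul C).mono' (h.aestronglyMeasurable.smul hm) ?_
  have h0 : ∀ᵐ t : V, t ≠ 0 := by simp [ae_iff]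
  filter_upwards [h0] with t ht
  rw [norm_smul, Real.norm_of_nonneg (by positivity)]
  calc _ ≤ ((1 + ‖t‖) ^ (Module.finrank ℝ V + 2))⁻¹ *
        (C * (‖t‖ ^ (1 - Module.finrank ℝ V : ℝ) + ‖t‖)) := by gcongr; exact hK t ht
    _ = _ := by simp only [Pi.add_apply, Real.rpow_one]; ring

theorem IntegrableUpToGrowth.integrable_bilin {K : V → E'} (hK : IntegrableUpToGrowth K)
    (L : E →L[ℝ] E' →L[ℝ] W) (f : 𝓢(V, E)) (x : V) :
    Integrable (fun t => L (f (x - t)) (K t)) := by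
  have hm := hK.aestronglyMeasurable
  obtain ⟨N, hN⟩ := hK
  obtain ⟨C, hC, hf⟩ := f.exists_norm_le_inv_one_add_pow N
  refine (hN.norm.const_mul (‖L‖ * (C * (1 + ‖x‖) ^ N))).mono'
    (L.aestronglyMeasurable_comp₂
      (f.continuous.comp (continuous_const.sub continuous_id)).aestronglyMeasurable hm)
    (ae_of_all _ fun t => ?_)
  calc ‖L (f (x - t)) (K t)‖ ≤ ‖L‖ * ‖f (x - t)‖ * ‖K t‖ := L.le_opNorm₂ _ _
    _ ≤ ‖L‖ * (C * ((1 + ‖x‖) ^ N * ((1 + ‖t‖) ^ N)⁻¹)) * ‖K t‖ := by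
        gcongr
        exact (hf _).trans (by gcongr; exact inv_one_add_norm_sub_pow_le x t N)
    _ = _ := by
        rw [norm_smul, norm_inv, norm_pow, Real.norm_of_nonneg (by positivity : 0 ≤ 1 + ‖t‖)]
        ring

theorem IntegrableUpToGrowth.integrable_smul {G : V → ℝ} (hG : IntegrableUpToGrowth G)
    (f : 𝓢(V, E)) (x : V) : Integrable (fun t => G t • f (x - t)) :=
  hG.integrable_bilin (ContinuousLinearMap.lsmul ℝ ℝ).flip f x

/-- The derivative falls on the Schwartz factor, so the kernel needs no regularity. For y in the
unit ball about x, the Peetre factor is at most (2 + ‖x‖)^N, which gives a majorant independent of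
y. -/
theorem IntegrableUpToGrowth.hasFDerivAt_integral {G : V → ℝ} (hG : IntegrableUpToGrowth G)
    (f : 𝓢(V, E)) (x : V) :
    HasFDerivAt (fun x => ∫ t, G t • f (x - t))
      (∫ t, G t • SchwartzMap.fderivCLM ℝ V E f (x - t)) x := by
  have hint := hG.integrable_smul f
  have hint' := hG.integrable_smul (SchwartzMap.fderivCLM ℝ V E f)
  obtain ⟨N, hN⟩ := hG
  obtain ⟨C, hC, hf⟩ := (SchwartzMap.fderivCLM ℝ V E f).exists_norm_le_inv_one_add_pow N
  refine hasFDerivAt_integral_of_dominated_of_fderiv_le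
    (F' := fun y t => G t • SchwartzMap.fderivCLM ℝ V E f (y - t))
    (bound := fun t => C * (2 + ‖x‖) ^ N * ‖((1 + ‖t‖) ^ N)⁻¹ • G t‖)
    (Metric.ball_mem_nhds x one_pos)
    (Filter.Eventually.of_forall fun y => (hint y).aestronglyMeasurable) (hint x)
    (hint' x).aestronglyMeasurable ?_ (hN.norm.const_mul _) ?_
  · refine ae_of_all _ fun t y hy => ?_
    have hy' : ‖y‖ ≤ 1 + ‖x‖ := by
      have := norm_sub_norm_le y x
      rw [Metric.mem_ball, dist_eq_norm] at hy
      linarith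
    rw [norm_smul, norm_smul, norm_inv, norm_pow,
      Real.norm_of_nonneg (by positivity : 0 ≤ 1 + ‖t‖)]
    calc _ ≤ ‖G t‖ * (C * ((1 + ‖y‖) ^ N * ((1 + ‖t‖) ^ N)⁻¹)) := by
          gcongr
          exact (hf _).trans (by gcongr; exact inv_one_add_norm_sub_pow_le y t N)
      _ ≤ ‖G t‖ * (C * ((2 + ‖x‖) ^ N * ((1 + ‖t‖) ^ N)⁻¹)) := by
          have : 1 + ‖y‖ ≤ 2 + ‖x‖ := by linarith
          gcongr
      _ = _ := by ring
  · refine ae_of_all _ fun t y _ => ?_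
    have h := (f.hasFDerivAt (y - t)).comp y ((hasFDerivAt_id y).sub_const t)
    exact h.const_smul (G t)

open LineDeriv in
theorem IntegrableUpToGrowth.fderiv_integral {G : V → ℝ} (hG : IntegrableUpToGrowth G)
    (f : 𝓢(V, E)) (x v : V) :
    fderiv ℝ (fun x => ∫ t, G t • f (x - t)) x v = ∫ t, G t • (∂_{v} f) (x - t) := by
  rw [(hG.hasFDerivAt_integral f x).fderiv,
    ContinuousLinearMap.integral_apply (hG.integrable_smul (SchwartzMap.fderivCLM ℝ V E f) x)]
  rfl

theorem IntegrableUpToGrowth.contDiff_integral {G : V → ℝ} (hG : IntegrableUpToGrowth G)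
    (f : 𝓢(V, E)) (n : ℕ∞) : ContDiff ℝ n (fun x => ∫ t, G t • f (x - t)) := by
  -- The induction quantifies over `f`, since a directional derivative is the same integral with ∂_v
  -- f in place of `f`.
  suffices h : ∀ (n : ℕ) (f : 𝓢(V, E)), ContDiff ℝ n (fun x => ∫ t, G t • f (x - t)) by
    have h' : ContDiff ℝ ((⊤ : ℕ∞) : WithTop ℕ∞) (fun x => ∫ t, G t • f (x - t)) :=
      contDiff_infty.2 fun n => h n f
    exact h'.of_le (by exact_mod_cast le_top)
  intro n
  induction n with
  | zero =>
    intro f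
    refine contDiff_zero.2 (Differentiable.continuous (𝕜 := ℝ) fun x => ?_)
    exact (hG.hasFDerivAt_integral f x).differentiableAt
  | succ n ih =>
    intro f
    push_cast
    rw [contDiff_succ_iff_fderiv_apply]
    refine ⟨fun x => (hG.hasFDerivAt_integral f x).differentiableAt, by simp, fun v => ?_⟩
    simp_rw [hG.fderiv_integral f]
    exact ih _

open Laplacian LineDeriv in
theorem IntegrableUpToGrowth.laplacian_integral {G : V → ℝ} (hG : IntegrableUpToGrowth G)
    (f : 𝓢(V, E)) (x : V) :
    Δ (fun x => ∫ t, G t • f (x - t)) x = ∫ t, G t • (Δ f) (x - t) := by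
  have h2 : ∀ v, iteratedFDeriv ℝ 2 (fun x => ∫ t, G t • f (x - t)) x ![v, v] =
      ∫ t, G t • (∂_{v} (∂_{v} f)) (x - t) := by
    intro v
    rw [iteratedFDeriv_two_apply]
    simp only [Matrix.cons_val_zero, Matrix.cons_val_one]
    have hd : DifferentiableAt ℝ (fderiv ℝ fun x => ∫ t, G t • f (x - t)) x :=
      ((hG.contDiff_integral f 2).fderiv_right (m := 1) one_add_one_eq_two.le).differentiable
        one_ne_zero x
    rw [← hG.fderiv_integral, ← funext fun y => hG.fderiv_integral f y v]
    rw [fderiv_clm_apply hd (differentiableAt_const v)]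
    simp
  rw [InnerProductSpace.laplacian_eq_iteratedFDeriv_orthonormalBasis _ (stdOrthonormalBasis ℝ V)]
  simp_rw [h2, SchwartzMap.laplacian_eq_sum (stdOrthonormalBasis ℝ V), sum_apply,
    Finset.smul_sum]
  rw [integral_finsetSum _ fun i _ => hG.integrable_smul _ x]

end SlowGrowth

/-! ### Radial kernels with Laplace-type derivative, and their smoothing. -/

section RadialKernel

open Set Filter Topology

variable {V : Type*} [NormedAddCommGroup V]

/-- The smoothing `√(‖t‖² + ε)` of the norm. -/
noncomputable def smoothNorm (ε : ℝ) (t : V) : ℝ := √(‖t‖ ^ 2 + ε)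

theorem smoothNorm_pos {ε : ℝ} (hε : 0 < ε) (t : V) : 0 < smoothNorm ε t :=
  Real.sqrt_pos.2 (by positivity)

theorem norm_le_smoothNorm {ε : ℝ} (hε : 0 < ε) (t : V) : ‖t‖ ≤ smoothNorm ε t :=
  Real.le_sqrt_of_sq_le (by linarith)

theorem smoothNorm_le {ε : ℝ} (hε : ε ≤ 1) (t : V) : smoothNorm ε t ≤ ‖t‖ + 1 := by
  refine Real.sqrt_le_iff.2 ⟨by positivity, ?_⟩
  nlinarith [norm_nonneg t]

theorem continuous_smoothNorm (ε : ℝ) : Continuous (smoothNorm ε : V → ℝ) := by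
  unfold smoothNorm
  fun_prop

theorem tendsto_smoothNorm {ε : ℕ → ℝ} (hε : Tendsto ε atTop (𝓝 0)) (t : V) :
    Tendsto (fun k => smoothNorm (ε k) t) atTop (𝓝 ‖t‖) := by
  have h : Tendsto (fun k => √(‖t‖ ^ 2 + ε k)) atTop (𝓝 (√(‖t‖ ^ 2 + 0))) :=
    (hε.const_add _).sqrt
  rwa [add_zero, Real.sqrt_sq (norm_nonneg t)] at h

variable [InnerProductSpace ℝ V]

/-- The radial profile `g` has derivative `c r^{1-n}`, where `n` is the dimension of `V`, and is
bounded by a multiple of `r^{1-n} + r`. -/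
structure IsLaplaceProfile (V : Type*) [NormedAddCommGroup V] [InnerProductSpace ℝ V]
    (g : ℝ → ℝ) (c C : ℝ) : Prop where
  hasDerivAt : ∀ r > 0, HasDerivAt g (c * r ^ (1 - Module.finrank ℝ V : ℝ)) r
  abs_le : ∀ r > 0, |g r| ≤ C * (r ^ (1 - Module.finrank ℝ V : ℝ) + r)

variable {g : ℝ → ℝ} {c C : ℝ}

theorem IsLaplaceProfile.nonneg (hg : IsLaplaceProfile V g c C) : 0 ≤ C := by
  have h := (abs_nonneg _).trans (hg.abs_le 1 one_pos)
  rw [Real.one_rpow] at h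
  linarith

theorem IsLaplaceProfile.continuousOn (hg : IsLaplaceProfile V g c C) : ContinuousOn g (Ioi 0) :=
  fun r hr => (hg.hasDerivAt r hr).continuousAt.continuousWithinAt

theorem norm_const_mul_norm_rpow_smul_self_le (c : ℝ) (t : V) (ht : t ≠ 0) :
    ‖(c * ‖t‖ ^ (-Module.finrank ℝ V : ℝ)) • t‖ = |c| * ‖t‖ ^ (1 - Module.finrank ℝ V : ℝ) := by
  have h : 0 < ‖t‖ := norm_pos_iff.2 ht
  rw [norm_smul, norm_mul, Real.norm_eq_abs, Real.norm_of_nonneg (by positivity), mul_assoc,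
    ← Real.rpow_add_one h.ne']
  congr 2
  ring

theorem hasFDerivAt_smoothNorm {ε : ℝ} (hε : 0 < ε) (t : V) :
    HasFDerivAt (smoothNorm ε) ((smoothNorm ε t)⁻¹ • innerSL ℝ t) t := by
  have h2 := (((hasStrictFDerivAt_norm_sq t).hasFDerivAt).add_const ε).sqrt (by positivity)
  refine h2.congr_fderiv ?_
  have := smoothNorm_pos hε t
  ext v
  rw [smoothNorm] at this
  simp [smoothNorm]
  field_simp

theorem IsLaplaceProfile.hasFDerivAt_smoothNorm (hg : IsLaplaceProfile V g c C) {ε : ℝ}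
    (hε : 0 < ε) (t : V) :
    HasFDerivAt (fun t : V => g (smoothNorm ε t))
      ((c * smoothNorm ε t ^ (-Module.finrank ℝ V : ℝ)) • innerSL ℝ t) t := by
  have h := smoothNorm_pos hε t
  refine ((hg.hasDerivAt _ h).comp_hasFDerivAt t
    (_root_.hasFDerivAt_smoothNorm hε t)).congr_fderiv ?_
  rw [smul_smul, sub_eq_add_neg, add_comm, Real.rpow_add_one h.ne']
  congr 1
  field_simp

/-- The smoothed norm dominates the norm and the exponent is nonpositive, so the bound does not
depend on ε and can serve as a majorant when ε → 0. -/
theorem norm_smoothNorm_rpow_mul_inner_le (c : ℝ) {ε : ℝ} (hε : 0 < ε) {t : V} (ht : t ≠ 0)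
    (v : V) : |c * smoothNorm ε t ^ (-Module.finrank ℝ V : ℝ) * inner ℝ t v| ≤
      |c| * ‖v‖ * ‖t‖ ^ (1 - Module.finrank ℝ V : ℝ) := by
  have h : 0 < ‖t‖ := norm_pos_iff.2 ht
  have h1 : smoothNorm ε t ^ (-Module.finrank ℝ V : ℝ) ≤ ‖t‖ ^ (-Module.finrank ℝ V : ℝ) :=
    Real.rpow_le_rpow_of_nonpos h (norm_le_smoothNorm hε t) (by simp)
  have h0 := Real.rpow_nonneg (smoothNorm_pos hε t).le (-Module.finrank ℝ V : ℝ)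
  rw [abs_mul, abs_mul, abs_of_nonneg h0, sub_eq_add_neg, add_comm, Real.rpow_add_one h.ne']
  calc _ ≤ |c| * ‖t‖ ^ (-Module.finrank ℝ V : ℝ) * (‖t‖ * ‖v‖) := by
        gcongr
        exact abs_real_inner_le_norm t v
    _ = _ := by ring

theorem IsLaplaceProfile.hasGradientAt [CompleteSpace V] (hg : IsLaplaceProfile V g c C) {t : V}
    (ht : t ≠ 0) :
    HasGradientAt (fun t : V => g ‖t‖) ((c * ‖t‖ ^ (-Module.finrank ℝ V : ℝ)) • t) t := by
  have h : 0 < ‖t‖ := norm_pos_iff.2 ht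
  have h1 : HasFDerivAt (fun t : V => ‖t‖) (‖t‖⁻¹ • innerSL ℝ t) t := by
    have h2 := ((hasStrictFDerivAt_norm_sq t).hasFDerivAt).sqrt (by positivity)
    simp only [Real.sqrt_sq (norm_nonneg _)] at h2
    refine h2.congr_fderiv ?_
    ext v
    simp
    field_simp
  rw [hasGradientAt_iff_hasFDerivAt]
  refine ((hg.hasDerivAt _ h).comp_hasFDerivAt t h1).congr_fderiv ?_
  ext v
  simp only [InnerProductSpace.toDual_apply_apply, inner_smul_left, smul_apply,
    innerSL_apply_apply, smul_eq_mul, conj_trivial]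
  rw [sub_eq_add_neg, add_comm, Real.rpow_add_one h.ne']
  field_simp

theorem IsLaplaceProfile.abs_smoothNorm_le [FiniteDimensional ℝ V] [Nontrivial V]
    (hg : IsLaplaceProfile V g c C) {ε : ℝ} (hε : 0 < ε) (hε' : ε ≤ 1) {t : V} (ht : t ≠ 0) :
    |g (smoothNorm ε t)| ≤ C * (2 * (‖t‖ ^ (1 - Module.finrank ℝ V : ℝ) + ‖t‖)) := by
  have h : 0 < ‖t‖ := norm_pos_iff.2 ht
  have hd : (1 : ℝ) ≤ Module.finrank ℝ V := by exact_mod_cast Module.finrank_pos (R := ℝ) (M := V)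
  refine (hg.abs_le _ (smoothNorm_pos hε t)).trans (mul_le_mul_of_nonneg_left ?_ hg.nonneg)
  have h1 : smoothNorm ε t ^ (1 - Module.finrank ℝ V : ℝ) ≤ ‖t‖ ^ (1 - Module.finrank ℝ V : ℝ) :=
    Real.rpow_le_rpow_of_nonpos h (norm_le_smoothNorm hε t) (by linarith)
  -- This absorbs the summand 1 in `smoothNorm_le`, and is the source of the factor 2.
  have h2 : 1 ≤ ‖t‖ ^ (1 - Module.finrank ℝ V : ℝ) + ‖t‖ := by
    rcases le_total ‖t‖ 1 with h3 | h3
    · linarith [Real.one_le_rpow_of_pos_of_le_one_of_nonpos h h3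
        (by linarith : (1 - Module.finrank ℝ V : ℝ) ≤ 0)]
    · linarith [Real.rpow_nonneg h.le (1 - Module.finrank ℝ V : ℝ)]
  linarith [smoothNorm_le hε' t]

variable [FiniteDimensional ℝ V] [MeasurableSpace V] [BorelSpace V]

theorem aestronglyMeasurable_of_continuousOn_compl_zero [Nontrivial V] {E : Type*}
    [NormedAddCommGroup E] {K : V → E} (h : ContinuousOn K {0}ᶜ) : AEStronglyMeasurable K := by
  have := h.aestronglyMeasurable (μ := (volume : Measure V)) (measurableSet_singleton 0).compl
  rwa [restrict_compl_singleton] at this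

theorem IsLaplaceProfile.integrableUpToGrowth [Nontrivial V] (hg : IsLaplaceProfile V g c C) :
    IntegrableUpToGrowth (fun t : V => g ‖t‖) := by
  refine IntegrableUpToGrowth.of_norm_le (C := C) ?_ fun t ht => hg.abs_le _ (norm_pos_iff.2 ht)
  refine aestronglyMeasurable_of_continuousOn_compl_zero ?_
  exact hg.continuousOn.comp continuous_norm.continuousOn fun t ht => norm_pos_iff.2 ht

theorem integrableUpToGrowth_norm_rpow_smul_self [Nontrivial V] (c : ℝ) :
    IntegrableUpToGrowth (fun t : V => (c * ‖t‖ ^ (-Module.finrank ℝ V : ℝ)) • t) := by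
  refine IntegrableUpToGrowth.of_norm_le (C := |c|) ?_ fun t ht => ?_
  · exact (by fun_prop : Measurable _).aestronglyMeasurable
  · rw [norm_const_mul_norm_rpow_smul_self_le c t ht]
    gcongr
    linarith [norm_nonneg t]

end RadialKernel

/-! ### The Laplace equation of a radial kernel, tested against Schwartz functions. -/

section FundamentalSolution

open Set Filter Topology LineDeriv

variable {V : Type*} [NormedAddCommGroup V] [InnerProductSpace ℝ V]

theorem SchwartzMap.integral_Ioi_fderiv_smul (h : 𝓢(V, ℝ)) {ω : V} (hω : ‖ω‖ = 1) :
    ∫ r in Ioi (0 : ℝ), fderiv ℝ h (r • ω) ω = -h 0 := by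
  have hd : ∀ r : ℝ, HasDerivAt (fun r : ℝ => h (r • ω)) (fderiv ℝ h (r • ω) ω) r := fun r => by
    have h1 : HasDerivAt (fun r : ℝ => r • ω) ω r := by
      simpa using (hasDerivAt_id r).smul_const ω
    exact (h.hasFDerivAt (r • ω)).comp_hasDerivAt r h1
  obtain ⟨A, hA, hfA⟩ := (SchwartzMap.fderivCLM ℝ V ℝ h).exists_norm_le_inv_one_add_pow 2
  obtain ⟨B, hB, hfB⟩ := h.exists_norm_le_inv_one_add_pow 1
  have hint : IntegrableOn (fun r : ℝ => fderiv ℝ h (r • ω) ω) (Ioi 0) := by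
    refine ((integrableOn_rpow_mul_inv_one_add_pow (β := 0) (N := 2) (by norm_num)
      (by norm_num)).const_mul A).mono' ?_ ?_
    · have : Continuous fun r : ℝ => ∂_{ω} h (r • ω) := by fun_prop
      exact this.aestronglyMeasurable
    · filter_upwards [ae_restrict_mem measurableSet_Ioi] with r hr
      refine ((fderiv ℝ h (r • ω)).le_opNorm ω).trans ?_
      have := hfA (r • ω)
      rw [norm_smul, hω, mul_one, Real.norm_of_nonneg (le_of_lt hr)] at this
      simpa [hω] using this
  have hlim : Tendsto (fun r : ℝ => h (r • ω)) atTop (𝓝 0) := by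
    refine squeeze_zero_norm' (a := fun r => B * (1 + r)⁻¹) ?_ ?_
    · filter_upwards [eventually_ge_atTop 0] with r hr
      have := hfB (r • ω)
      rwa [norm_smul, hω, mul_one, Real.norm_of_nonneg hr, pow_one] at this
    · have := (tendsto_inv_atTop_zero.comp (tendsto_atTop_add_const_left _ (1 : ℝ) tendsto_id))
      simpa using this.const_mul B
  have := integral_Ioi_of_hasDerivAt_of_tendsto
    (hd 0).continuousAt.continuousWithinAt (fun r _ => hd r) hint hlim
  simpa using this

variable [FiniteDimensional ℝ V]
  [MeasurableSpace V] [BorelSpace V] [Nontrivial V]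
  {g : ℝ → ℝ} {c C : ℝ}

theorem SchwartzMap.integrable_mul_of_abs_le (h : 𝓢(V, ℝ)) {K : V → ℝ} (hm : AEStronglyMeasurable K)
    {C : ℝ} (hK : ∀ t ≠ 0, |K t| ≤ C * (‖t‖ ^ (1 - Module.finrank ℝ V : ℝ) + ‖t‖)) :
    Integrable (fun t => K t * h t) := by
  -- A product integral is a convolution with the reflected function, evaluated at 0.
  have h := (IntegrableUpToGrowth.of_norm_le hm hK).integrable_smul
    (SchwartzMap.compCLMOfContinuousLinearEquiv ℝ (ContinuousLinearEquiv.neg ℝ) h) 0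
  simpa using h

/-- The smoothed kernel is differentiable at the origin too, so integration by parts produces no
boundary term. -/
theorem IsLaplaceProfile.integral_smoothNorm_mul_lineDeriv (hg : IsLaplaceProfile V g c C)
    (h : 𝓢(V, ℝ)) (v : V) {ε : ℝ} (hε : 0 < ε) (hε' : ε ≤ 1) :
    ∫ t, g (smoothNorm ε t) * ∂_{v} h t =
      -∫ t, c * smoothNorm ε t ^ (-Module.finrank ℝ V : ℝ) * inner ℝ t v * h t := by
  have hcont : Continuous fun t : V => g (smoothNorm ε t) :=
    hg.continuousOn.comp_continuous (continuous_smoothNorm ε) fun t => smoothNorm_pos hε t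
  have hm : AEStronglyMeasurable (fun t : V => g (smoothNorm ε t)) := hcont.aestronglyMeasurable
  have hb : ∀ t : V, t ≠ 0 → |g (smoothNorm ε t)| ≤
      C * 2 * (‖t‖ ^ (1 - Module.finrank ℝ V : ℝ) + ‖t‖) := fun t ht => by
    rw [mul_assoc]; exact hg.abs_smoothNorm_le hε hε' ht
  refine integral_bilinear_hasFDerivAt_right_eq_neg_left_of_integrable
    (f := fun t : V => g (smoothNorm ε t)) (B := ContinuousLinearMap.mul ℝ ℝ)
    (f' := fun t => (c * smoothNorm ε t ^ (-Module.finrank ℝ V : ℝ)) • innerSL ℝ t)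
    (g' := fun t => fderiv ℝ h t) (v := v) ?_ ?_ ?_
    (fun t _ => hg.hasFDerivAt_smoothNorm hε t) (fun t _ => h.hasFDerivAt t)
  · refine h.integrable_mul_of_abs_le (C := |c| * ‖v‖) (Continuous.aestronglyMeasurable ?_) ?_
    · simp only [smul_apply, innerSL_apply_apply, smul_eq_mul]
      refine (continuous_const.mul ((continuous_smoothNorm ε).rpow_const fun t =>
        Or.inl (smoothNorm_pos hε t).ne')).mul (by fun_prop)
    · intro t ht
      refine (norm_smoothNorm_rpow_mul_inner_le c hε ht v).trans ?_
      gcongr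
      linarith [norm_nonneg t]
  · exact (∂_{v} h).integrable_mul_of_abs_le hm hb
  · exact h.integrable_mul_of_abs_le hm hb

/-- Dominated convergence as ε → 0 on both sides of the smoothed identity; this replaces excising a
small ball around the singularity. -/
theorem IsLaplaceProfile.integral_mul_lineDeriv (hg : IsLaplaceProfile V g c C)
    (h : 𝓢(V, ℝ)) (v : V) :
    ∫ t, g ‖t‖ * ∂_{v} h t =
      -∫ t, c * ‖t‖ ^ (-Module.finrank ℝ V : ℝ) * inner ℝ t v * h t := by
  let ε : ℕ → ℝ := fun k => 1 / ((k : ℝ) + 1)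
  have hε : Tendsto ε atTop (𝓝 0) := tendsto_one_div_add_atTop_nhds_zero_nat
  have hpos : ∀ k, 0 < ε k := fun k => by positivity
  have hle : ∀ k, ε k ≤ 1 := fun k => by
    rw [div_le_one (by positivity)]
    linarith [(Nat.cast_nonneg k : (0 : ℝ) ≤ k)]
  have h0 : ∀ᵐ t : V, t ≠ 0 := by simp [ae_iff]
  have hcont : ∀ k, Continuous fun t : V => g (smoothNorm (ε k) t) := fun k =>
    hg.continuousOn.comp_continuous (continuous_smoothNorm _) fun t => smoothNorm_pos (hpos k) t
  have hint : ∀ u : 𝓢(V, ℝ),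
      Integrable (fun t => (‖t‖ ^ (1 - Module.finrank ℝ V : ℝ) + ‖t‖) * ‖u t‖) := fun u => by
    refine (u.integrable_mul_of_abs_le (K := fun t => ‖t‖ ^ (1 - Module.finrank ℝ V : ℝ) + ‖t‖)
      (C := 1) (by fun_prop : Measurable _).aestronglyMeasurable fun t _ => ?_).norm.congr
      (ae_of_all _ fun t => ?_)
    · rw [abs_of_nonneg (by positivity), one_mul]
    · simp only [norm_mul]
      rw [Real.norm_of_nonneg (by positivity)]
  have h1 : Tendsto (fun k => ∫ t, g (smoothNorm (ε k) t) * ∂_{v} h t) atTop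
      (𝓝 (∫ t, g ‖t‖ * ∂_{v} h t)) := by
    refine tendsto_integral_of_dominated_convergence
      (fun t => C * 2 * ((‖t‖ ^ (1 - Module.finrank ℝ V : ℝ) + ‖t‖) * ‖∂_{v} h t‖))
      (fun k => ((hcont k).mul (∂_{v} h).continuous).aestronglyMeasurable)
      ((hint _).const_mul _) (fun k => ?_) ?_
    · filter_upwards [h0] with t ht
      rw [norm_mul, ← mul_assoc, Real.norm_eq_abs (g _), mul_assoc C]
      gcongr
      exact hg.abs_smoothNorm_le (hpos k) (hle k) ht
    · filter_upwards [h0] with t ht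
      refine Tendsto.mul_const _ ?_
      exact (hg.hasDerivAt _ (norm_pos_iff.2 ht)).continuousAt.tendsto.comp
        (tendsto_smoothNorm hε t)
  have h2 : Tendsto (fun k => ∫ t, c * smoothNorm (ε k) t ^ (-Module.finrank ℝ V : ℝ) *
      inner ℝ t v * h t) atTop
      (𝓝 (∫ t, c * ‖t‖ ^ (-Module.finrank ℝ V : ℝ) * inner ℝ t v * h t)) := by
    refine tendsto_integral_of_dominated_convergence
      (fun t => |c| * ‖v‖ * ((‖t‖ ^ (1 - Module.finrank ℝ V : ℝ) + ‖t‖) * ‖h t‖))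
      (fun k => ?_) ((hint _).const_mul _) (fun k => ?_) ?_
    · refine (((continuous_const.mul ((continuous_smoothNorm _).rpow_const fun t =>
        Or.inl (smoothNorm_pos (hpos k) t).ne')).mul (by fun_prop)).mul
        h.continuous).aestronglyMeasurable
    · filter_upwards [h0] with t ht
      rw [norm_mul, ← mul_assoc, Real.norm_eq_abs (_ * _)]
      gcongr
      refine (norm_smoothNorm_rpow_mul_inner_le c (hpos k) ht v).trans ?_
      gcongr
      linarith [norm_nonneg t]
    · filter_upwards [h0] with t ht
      refine ((Tendsto.const_mul _ ?_).mul_const _).mul_const _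
      exact (tendsto_smoothNorm hε t).rpow_const (Or.inl (norm_ne_zero_iff.2 ht))
  refine tendsto_nhds_unique h1 (h2.neg.congr fun k => ?_)
  exact (hg.integral_smoothNorm_mul_lineDeriv h v (hpos k) (hle k)).symm

/-- In polar coordinates the powers r^(n-1), r^(-n) and r cancel. What remains on each ray is the
radial derivative of h, whose integral is -h(0). -/
theorem SchwartzMap.integral_rpow_mul_fderiv_self (h : 𝓢(V, ℝ)) (c : ℝ) :
    ∫ t, c * ‖t‖ ^ (-Module.finrank ℝ V : ℝ) * fderiv ℝ h t t =
      -(c * (volume : Measure V).toSphere.real univ * h 0) := by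
  have hint : Integrable fun t => c * ‖t‖ ^ (-Module.finrank ℝ V : ℝ) * fderiv ℝ h t t := by
    have h1 := (SchwartzMap.fderivCLM ℝ V ℝ h).integrable_norm_rpow_smul
      (β := 1 - Module.finrank ℝ V) (by linarith)
    have hm : Measurable fun t : V => c * ‖t‖ ^ (-Module.finrank ℝ V : ℝ) := by fun_prop
    have hc : Continuous fun t => fderiv ℝ h t t :=
      (SchwartzMap.fderivCLM ℝ V ℝ h).continuous.clm_apply continuous_id
    refine (h1.norm.const_mul |c|).mono' (hm.aestronglyMeasurable.mul hc.aestronglyMeasurable) ?_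
    have h0 : ∀ᵐ t : V, t ≠ 0 := by simp [ae_iff]
    filter_upwards [h0] with t ht
    have ht' := norm_pos_iff.2 ht
    have hp (β : ℝ) : ‖‖t‖ ^ β‖ = ‖t‖ ^ β := Real.norm_of_nonneg (by positivity)
    rw [norm_mul, norm_mul, norm_smul, Real.norm_eq_abs c, hp, hp, sub_eq_add_neg, add_comm,
      Real.rpow_add_one ht'.ne']
    calc _ ≤ |c| * ‖t‖ ^ (-Module.finrank ℝ V : ℝ) * (‖fderiv ℝ h t‖ * ‖t‖) := by
          gcongr; exact (fderiv ℝ h t).le_opNorm t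
      _ = _ := by rw [SchwartzMap.fderivCLM_apply]; ring
  rw [integral_polar hint]
  have : ∀ ω : Metric.sphere (0 : V) 1, ∫ r in Ioi (0 : ℝ), r ^ (Module.finrank ℝ V - 1) •
      (c * ‖r • (ω : V)‖ ^ (-Module.finrank ℝ V : ℝ) *
        fderiv ℝ h (r • (ω : V)) (r • (ω : V))) = -(c * h 0) := by
    intro ω
    have hω : ‖(ω : V)‖ = 1 := by simp
    rw [← mul_neg, ← h.integral_Ioi_fderiv_smul hω, ← integral_const_mul]
    refine setIntegral_congr_fun measurableSet_Ioi fun r (hr : 0 < r) => ?_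
    have hd : 1 ≤ Module.finrank ℝ V := Module.finrank_pos
    simp only [norm_smul, hω, mul_one, Real.norm_of_nonneg hr.le, map_smul, smul_eq_mul]
    rw [Real.rpow_neg hr.le, Real.rpow_natCast, ← Nat.sub_add_cancel hd]
    simp only [Nat.add_sub_cancel, pow_succ]
    field_simp
  simp_rw [this]
  rw [integral_const, smul_eq_mul]
  ring

-- Integrating each second derivative by parts once gives minus the integral of c‖t‖^(-n) times the
-- derivative of h at t in direction t, which the polar computation evaluates.
open Laplacian in
theorem IsLaplaceProfile.integral_mul_laplacian (hg : IsLaplaceProfile V g c C) (h : 𝓢(V, ℝ)) :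
    ∫ t, g ‖t‖ * Δ h t = c * (volume : Measure V).toSphere.real univ * h 0 := by
  let b := stdOrthonormalBasis ℝ V
  have hi : ∀ i, Integrable fun t => g ‖t‖ * ∂_{b i} (∂_{b i} h) t := fun i =>
    (∂_{b i} (∂_{b i} h)).integrable_mul_of_abs_le hg.integrableUpToGrowth.aestronglyMeasurable
      fun t ht => hg.abs_le _ (norm_pos_iff.2 ht)
  have hi' : ∀ i, Integrable fun t =>
      c * ‖t‖ ^ (-Module.finrank ℝ V : ℝ) * inner ℝ t (b i) * ∂_{b i} h t := fun i => by
    refine (∂_{b i} h).integrable_mul_of_abs_le (C := |c|)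
      (by fun_prop : Measurable _).aestronglyMeasurable fun t ht => ?_
    rw [abs_mul]
    have h1 := norm_const_mul_norm_rpow_smul_self_le c t ht
    rw [norm_smul, Real.norm_eq_abs] at h1
    calc _ ≤ |c * ‖t‖ ^ (-Module.finrank ℝ V : ℝ)| * ‖t‖ := by
          gcongr
          refine (abs_real_inner_le_norm _ _).trans ?_
          simp [b]
      _ ≤ _ := by rw [h1]; gcongr; linarith [norm_nonneg t]
  simp_rw [SchwartzMap.laplacian_eq_sum b, sum_apply, Finset.mul_sum]
  rw [integral_finsetSum _ fun i _ => hi i]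
  simp_rw [hg.integral_mul_lineDeriv]
  rw [Finset.sum_neg_distrib, ← integral_finsetSum _ fun i _ => hi' i, neg_eq_iff_eq_neg,
    ← h.integral_rpow_mul_fderiv_self]
  congr 1
  ext t
  simp_rw [mul_assoc, ← Finset.mul_sum]
  congr 2
  conv_rhs => rw [← b.sum_repr' t, map_sum]
  refine Finset.sum_congr rfl fun i _ => ?_
  rw [map_smul, smul_eq_mul, real_inner_comm, b.sum_repr', SchwartzMap.lineDerivOp_apply_eq_fderiv]

end FundamentalSolution

/-! ### The fundamental solution and its convolutions. -/

section FundSol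

open Set Filter Topology LineDeriv Laplacian

section Reflection

variable {V E : Type*} [NormedAddCommGroup V] [NormedSpace ℝ V] [NormedAddCommGroup E]
  [NormedSpace ℝ E]

/-- The Schwartz function `t ↦ f (x - t)`. -/
noncomputable def SchwartzMap.constSub (f : 𝓢(V, E)) (x : V) : 𝓢(V, E) :=
  SchwartzMap.compSubConstCLM ℝ x
    (SchwartzMap.compCLMOfContinuousLinearEquiv ℝ (ContinuousLinearEquiv.neg ℝ) f)

@[simp]
theorem SchwartzMap.constSub_apply (f : 𝓢(V, E)) (x t : V) : f.constSub x t = f (x - t) := by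
  simp [SchwartzMap.constSub]

theorem SchwartzMap.lineDerivOp_constSub (f : 𝓢(V, E)) (x v : V) :
    ∂_{v} (f.constSub x) = -(∂_{v} f).constSub x := by
  ext t
  rw [neg_apply, SchwartzMap.constSub_apply, SchwartzMap.lineDerivOp_apply_eq_fderiv,
    SchwartzMap.lineDerivOp_apply_eq_fderiv]
  have h : HasFDerivAt (f.constSub x) ((fderiv ℝ f (x - t)).comp (-ContinuousLinearMap.id ℝ V)) t :=
    ((f.hasFDerivAt (x - t)).comp t ((hasFDerivAt_id t).const_sub x)).congr_of_eventuallyEq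
      (Eventually.of_forall fun y => by simp)
  rw [h.fderiv]
  simp

end Reflection

theorem SchwartzMap.laplacian_constSub {V E : Type*} [NormedAddCommGroup V] [InnerProductSpace ℝ V]
    [FiniteDimensional ℝ V] [NormedAddCommGroup E] [NormedSpace ℝ E] (f : 𝓢(V, E)) (x : V) :
    Δ (f.constSub x) = (Δ f).constSub x := by
  have h : ∀ v, ∂_{v} (∂_{v} (f.constSub x)) = SchwartzMap.constSub (∂_{v} (∂_{v} f)) x := fun v => by
    rw [f.lineDerivOp_constSub, lineDerivOp_neg, SchwartzMap.lineDerivOp_constSub, neg_neg]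
  rw [SchwartzMap.laplacian_eq_sum (stdOrthonormalBasis ℝ V),
    SchwartzMap.laplacian_eq_sum (stdOrthonormalBasis ℝ V)]
  ext t
  simp only [h, sum_apply, SchwartzMap.constSub_apply]

variable {d : ℕ}

/-- The fundamental solution of the Laplace equation as a function of the norm. -/
noncomputable def fundSolProfile (d : ℕ) (r : ℝ) : ℝ :=
  if d = 2 then 1 / (2 * Real.pi) * Real.log r
  else -(Real.Gamma (d / 2 - 1) / (4 * Real.pi ^ (d / 2 : ℝ))) * r ^ (2 - d : ℝ)

theorem fundSol_eq_profile (d : ℕ) : fundSol d = fun x => fundSolProfile d ‖x‖ := rfl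

/-- The inverse of the area of the unit sphere of `ℝ^d`. -/
noncomputable def invSphereArea (d : ℕ) : ℝ := Real.Gamma (d / 2) / (2 * Real.pi ^ (d / 2 : ℝ))

/-- The sphere has d times the volume of the unit ball, and Γ(d/2 + 1) = (d/2) Γ(d/2). -/
theorem invSphereArea_mul_toSphere_univ (hd : 2 ≤ d) :
    invSphereArea d * (volume : Measure (Space d)).toSphere.real univ = 1 := by
  have : Nonempty (Fin d) := ⟨⟨0, by omega⟩⟩
  have hd0 : (0 : ℝ) < d := by exact_mod_cast (by omega : 0 < d)
  have hG : 0 < Real.Gamma ((d : ℝ) / 2) := Real.Gamma_pos_of_pos (by positivity)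
  rw [Measure.toSphere_real_apply_univ, Measure.real, EuclideanSpace.volume_ball,
    finrank_euclideanSpace]
  simp only [Fintype.card_fin, ENNReal.ofReal_one, one_pow, one_mul]
  rw [Real.Gamma_add_one (by positivity), ENNReal.toReal_ofReal (by positivity), invSphereArea,
    Real.sqrt_eq_rpow, ← Real.rpow_natCast, ← Real.rpow_mul Real.pi_pos.le]
  have hp : 0 < Real.pi ^ ((d : ℝ) / 2) := by positivity
  rw [show (1 / 2 * (d : ℝ)) = d / 2 by ring]
  field_simp

theorem isLaplaceProfile_fundSolProfile (hd : 2 ≤ d) :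
    ∃ C, IsLaplaceProfile (Space d) (fundSolProfile d) (invSphereArea d) C := by
  rcases eq_or_ne d 2 with rfl | h2
  · refine ⟨1 / (2 * Real.pi), ?_, ?_⟩ <;> intro r hr <;>
      simp only [fundSolProfile, if_true, finrank_euclideanSpace, Fintype.card_fin, invSphereArea]
    · refine ((Real.hasDerivAt_log hr.ne').const_mul (1 / (2 * Real.pi))).congr_deriv ?_
      norm_num [Real.rpow_neg_one]
    · rw [abs_mul, abs_of_pos (by positivity)]
      gcongr
      norm_num [Real.rpow_neg_one]
      -- The bound |log r| ≤ r⁻¹ + r comes from log s ≤ s - 1 at s = r and s = 1/r.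
      have h1 := Real.log_le_sub_one_of_pos hr
      have h3 := Real.log_le_sub_one_of_pos (inv_pos.2 hr)
      rw [Real.log_inv] at h3
      have := inv_pos.2 hr
      exact abs_le.2 ⟨by linarith, by linarith⟩
  · have h3 : (3 : ℝ) ≤ d := by exact_mod_cast (by omega : 3 ≤ d)
    have hG : 0 < Real.Gamma ((d : ℝ) / 2 - 1) := Real.Gamma_pos_of_pos (by linarith)
    have hp : 0 < Real.pi ^ ((d : ℝ) / 2) := by positivity
    refine ⟨Real.Gamma (d / 2 - 1) / (4 * Real.pi ^ (d / 2 : ℝ)), ?_, ?_⟩ <;> intro r hr <;>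
      simp only [fundSolProfile, if_neg h2, finrank_euclideanSpace, Fintype.card_fin,
        invSphereArea]
    · have h5 : fundSolProfile d = fun r => -(Real.Gamma (d / 2 - 1) /
          (4 * Real.pi ^ (d / 2 : ℝ))) * r ^ (2 - d : ℝ) := by
        ext r
        rw [fundSolProfile, if_neg h2]
      rw [h5]
      refine ((Real.hasDerivAt_rpow_const (p := (2 - d : ℝ)) (Or.inl hr.ne')).const_mul
        (-(Real.Gamma (d / 2 - 1) / (4 * Real.pi ^ (d / 2 : ℝ))))).congr_deriv ?_
      -- This turns (d - 2) Γ(d/2 - 1) / 4 into Γ(d/2) / 2, the numerator of the inverse sphere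
      -- area.
      have h4 : Real.Gamma ((d : ℝ) / 2) = (d / 2 - 1) * Real.Gamma (d / 2 - 1) := by
        rw [← Real.Gamma_add_one (by linarith), sub_add_cancel]
      rw [h4, show (2 - d - 1 : ℝ) = 1 - d by ring]
      field_simp
      ring
    · rw [abs_mul, abs_neg, abs_of_pos (by positivity), abs_of_pos (by positivity)]
      gcongr
      rcases le_total r 1 with hr1 | hr1
      · have := Real.rpow_le_rpow_of_exponent_ge hr hr1 (by linarith : (1 - d : ℝ) ≤ 2 - d)
        linarith
      · have := Real.rpow_le_one_of_one_le_of_nonpos hr1 (by linarith : (2 - d : ℝ) ≤ 0)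
        linarith [Real.rpow_nonneg hr.le (1 - d : ℝ)]

theorem integrableUpToGrowth_fundSol (hd : 2 ≤ d) : IntegrableUpToGrowth (fundSol d) := by
  have : Nonempty (Fin d) := ⟨⟨0, by omega⟩⟩
  obtain ⟨C, hC⟩ := isLaplaceProfile_fundSolProfile hd
  exact hC.integrableUpToGrowth

/-- The formula is derived away from the origin; almost everywhere is enough because the gradient
only enters under integrals. -/
theorem gradient_fundSol_ae (hd : 2 ≤ d) : gradient (fundSol d) =ᵐ[volume]
    fun t => (invSphereArea d * ‖t‖ ^ (-Module.finrank ℝ (Space d) : ℝ)) • t := by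
  have : Nonempty (Fin d) := ⟨⟨0, by omega⟩⟩
  obtain ⟨C, hC⟩ := isLaplaceProfile_fundSolProfile hd
  have h0 : ∀ᵐ t : Space d, t ≠ 0 := by simp [ae_iff]
  filter_upwards [h0] with t ht
  exact (hC.hasGradientAt ht).gradient

theorem integrableUpToGrowth_gradient_fundSol (hd : 2 ≤ d) :
    IntegrableUpToGrowth (gradient (fundSol d)) := by
  have : Nonempty (Fin d) := ⟨⟨0, by omega⟩⟩
  obtain ⟨N, hN⟩ := integrableUpToGrowth_norm_rpow_smul_self (V := Space d) (invSphereArea d)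
  refine ⟨N, hN.congr ?_⟩
  filter_upwards [gradient_fundSol_ae hd] with t ht
  rw [ht]

section Convolution

variable {E : Type*} [NormedAddCommGroup E] [NormedSpace ℝ E]

theorem SchwartzMap.convolution_lsmul_apply (f : 𝓢(Space d, ℝ)) (K : Space d → E) (x : Space d) :
    ((f : Space d → ℝ) ⋆[ContinuousLinearMap.lsmul ℝ ℝ, volume] K) x =
      ∫ t, f (x - t) • K t := by
  rw [convolution_def, ← integral_sub_left_eq_self _ volume x]
  simp

theorem IntegrableUpToGrowth.convolutionExists {K : Space d → E} (hK : IntegrableUpToGrowth K)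
    (f : 𝓢(Space d, ℝ)) :
    ConvolutionExists (f : Space d → ℝ) K (ContinuousLinearMap.lsmul ℝ ℝ) volume := by
  intro x
  have h := (hK.integrable_bilin (ContinuousLinearMap.lsmul ℝ ℝ) f x).comp_sub_left x
  simpa [ConvolutionExistsAt] using h

end Convolution

theorem SchwartzMap.convolution_fundSol_eq (f : 𝓢(Space d, ℝ)) :
    ((f : Space d → ℝ) ⋆[ContinuousLinearMap.lsmul ℝ ℝ, volume] fundSol d) =
      fun x => ∫ t, fundSol d t • f (x - t) := by
  ext x
  simp_rw [f.convolution_lsmul_apply, smul_eq_mul, mul_comm]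

/-- The weak Laplace equation, tested on t ↦ f(x - t), whose Laplacian is (Δf)(x - t). -/
theorem SchwartzMap.laplacian_convolution_fundSol (hd : 2 ≤ d) (f : 𝓢(Space d, ℝ)) (x : Space d) :
    ∫ t, fundSol d t • Δ f (x - t) = f x := by
  have : Nonempty (Fin d) := ⟨⟨0, by omega⟩⟩
  obtain ⟨C, hC⟩ := isLaplaceProfile_fundSolProfile hd
  have h := hC.integral_mul_laplacian (f.constSub x)
  rw [invSphereArea_mul_toSphere_univ hd, f.laplacian_constSub] at h
  simpa [fundSol_eq_profile] using h

/-- One integration by parts against t ↦ f(x - t); the sign from the reflection cancels the sign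
from the parts. -/
theorem SchwartzMap.convolution_gradient_fundSol (hd : 2 ≤ d) (f : 𝓢(Space d, ℝ))
    (x v : Space d) :
    inner ℝ (((f : Space d → ℝ) ⋆[ContinuousLinearMap.lsmul ℝ ℝ, volume]
      gradient (fundSol d)) x) v =
      ∫ t, fundSol d t • (∂_{v} f) (x - t) := by
  have : Nonempty (Fin d) := ⟨⟨0, by omega⟩⟩
  obtain ⟨C, hC⟩ := isLaplaceProfile_fundSolProfile hd
  have h := hC.integral_mul_lineDeriv (f.constSub x) v
  have hint : Integrable fun t => f (x - t) • gradient (fundSol d) t :=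
    (integrableUpToGrowth_gradient_fundSol hd).integrable_bilin
      (ContinuousLinearMap.lsmul ℝ ℝ) f x
  rw [f.convolution_lsmul_apply, real_inner_comm, ← integral_inner hint]
  simp only [f.lineDerivOp_constSub, neg_apply, SchwartzMap.constSub_apply, mul_neg,
    integral_neg, neg_inj] at h
  refine Eq.trans (integral_congr_ae ?_) h.symm
  filter_upwards [gradient_fundSol_ae hd] with t ht
  rw [ht, inner_smul_right, inner_smul_right, real_inner_comm]
  ring

end FundSol

/-! ### The Helmholtz decomposition of a Schwartz field. -/

section HelmholtzSchwartz

open LineDeriv Laplacian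

variable {d : ℕ}

/-- The `i`-th component of a Schwartz vector field. -/
noncomputable def SchwartzMap.coord (F : 𝓢(Space d, Space d)) (i : Fin d) : 𝓢(Space d, ℝ) :=
  SchwartzMap.postcompCLM (EuclideanSpace.proj (𝕜 := ℝ) i) F

@[simp]
theorem SchwartzMap.coord_apply (F : 𝓢(Space d, Space d)) (i : Fin d) (x : Space d) :
    F.coord i x = F x i := rfl

/-- The divergence of a Schwartz vector field as a Schwartz function. -/
noncomputable def SchwartzMap.div (F : 𝓢(Space d, Space d)) : 𝓢(Space d, ℝ) :=
  ∑ i, ∂_{(EuclideanSpace.single i 1 : Space d)} (F.coord i)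

theorem divergence_eq_div (F : 𝓢(Space d, Space d)) : divergence F = F.div := by
  ext x
  simp only [divergence, SchwartzMap.div, sum_apply, SchwartzMap.lineDerivOp_apply_eq_fderiv]
  rfl

/-- The Laplacian of the solenoidal part of a Schwartz vector field, componentwise, as a Schwartz
function. -/
noncomputable def SchwartzMap.lapSol (F : 𝓢(Space d, Space d)) (j : Fin d) : 𝓢(Space d, ℝ) :=
  Δ (F.coord j) - ∂_{(EuclideanSpace.single j 1 : Space d)} F.div

theorem potential_eq_integral (F : 𝓢(Space d, Space d)) :
    potential F = fun x => ∫ t, fundSol d t • F.div (x - t) := by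
  rw [potential, divergence_eq_div, SchwartzMap.convolution_fundSol_eq]

theorem potentialPart_apply (hd : 2 ≤ d) (F : 𝓢(Space d, Space d)) (x : Space d) (j : Fin d) :
    potentialPart F x j =
      ∫ t, fundSol d t • (∂_{(EuclideanSpace.single j 1 : Space d)} F.div) (x - t) := by
  rw [← (integrableUpToGrowth_fundSol hd).fderiv_integral F.div x, ← potential_eq_integral,
    potentialPart, gradient]
  have h := (InnerProductSpace.toDual_symm_apply (𝕜 := ℝ) (x := EuclideanSpace.single j 1)
    (y := fderiv ℝ (potential F) x))
  rw [← h, EuclideanSpace.inner_single_right]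
  simp

/-- The Laplacian passes under the convolution with G and is inverted by it, so the nonlocal part
∂_jφ contributes the Schwartz function ∂_jΦ. No decay of the solenoidal part itself is needed. -/
theorem lapSolenoidal_apply (hd : 2 ≤ d) (F : 𝓢(Space d, Space d)) (x : Space d) (j : Fin d) :
    lapSolenoidal F x j = F.lapSol j x := by
  have hG := integrableUpToGrowth_fundSol hd
  have h : (fun z => solenoidalPart F z j) = ⇑(F.coord j) - fun x => ∫ t, fundSol d t •
      (∂_{(EuclideanSpace.single j 1 : Space d)} F.div) (x - t) := by
    ext z
    simp [solenoidalPart, potentialPart_apply hd]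
  simp only [lapSolenoidal]
  rw [h, ((F.coord j).contDiffAt 2).laplacian_sub (hG.contDiff_integral _ 2).contDiffAt,
    hG.laplacian_integral, SchwartzMap.laplacian_convolution_fundSol hd,
    SchwartzMap.lapSol, sub_apply, SchwartzMap.laplacian_apply]

/-- The Laplacian of the solenoidal part of a Schwartz vector field as a Schwartz vector field. -/
noncomputable def SchwartzMap.lapSolField (F : 𝓢(Space d, Space d)) : 𝓢(Space d, Space d) :=
  ∑ j, SchwartzMap.postcompCLM
    (ContinuousLinearMap.toSpanSingleton ℝ (EuclideanSpace.single j 1 : Space d)) (F.lapSol j)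

theorem lapSolenoidal_eq_lapSolField (hd : 2 ≤ d) (F : 𝓢(Space d, Space d)) :
    lapSolenoidal F = F.lapSolField := by
  ext x j
  rw [lapSolenoidal_apply hd, SchwartzMap.lapSolField, sum_apply]
  simp [WithLp.ofLp_sum, Finset.sum_apply, Pi.single_apply]

theorem reconstruct_from_divergence_and_lapSolenoidal (hd : 2 ≤ d) (F : 𝓢(Space d, Space d))
    (x : Space d) : F x =
      (divergence F ⋆[ContinuousLinearMap.lsmul ℝ ℝ, volume] gradient (fundSol d)) x +
      ∑ j : Fin d, ((fun y => lapSolenoidal F y j)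
        ⋆[ContinuousLinearMap.lsmul ℝ ℝ, volume] fundSol d) x •
          (EuclideanSpace.single j 1 : Space d) := by
  have hG := integrableUpToGrowth_fundSol hd
  ext j
  have h1 := F.div.convolution_gradient_fundSol hd x (EuclideanSpace.single j 1)
  rw [EuclideanSpace.inner_single_right] at h1
  simp only [one_mul, conj_trivial] at h1
  have h2 : ((fun y => lapSolenoidal F y j)
        ⋆[ContinuousLinearMap.lsmul ℝ ℝ, volume] fundSol d) x = F x j -
        ∫ t, fundSol d t • (∂_{(EuclideanSpace.single j 1 : Space d)} F.div) (x - t) := by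
    rw [show (fun y => lapSolenoidal F y j) = F.lapSol j from
      funext fun y => lapSolenoidal_apply hd F y j, SchwartzMap.convolution_fundSol_eq]
    simp only [SchwartzMap.lapSol, sub_apply, smul_sub]
    rw [integral_sub (hG.integrable_smul _ x) (hG.integrable_smul _ x),
      SchwartzMap.laplacian_convolution_fundSol hd, SchwartzMap.coord_apply]
  rw [PiLp.add_apply, divergence_eq_div, h1]
  simp [WithLp.ofLp_sum, Finset.sum_apply, Pi.single_apply, h2]

end HelmholtzSchwartz

/-! ### The Radon transform of Schwartz functions and of their derivatives. -/

section RadonSchwartz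

open LineDeriv Laplacian

variable {d : ℕ} {M : Type*} [NormedAddCommGroup M] [NormedSpace ℝ M]

theorem USphere.inner_self (ω : USphere d) : inner ℝ (ω : Space d) (ω : Space d) = 1 := by
  simp

theorem norm_le_norm_smul_add_of_mem_orthogonal (ω : USphere d) (p : ℝ)
    (y : (Submodule.span ℝ {(ω : Space d)})ᗮ) : ‖y‖ ≤ ‖p • (ω : Space d) + y‖ := by
  have h : inner ℝ (p • (ω : Space d)) (y : Space d) = 0 := by
    rw [real_inner_smul_left, Submodule.mem_orthogonal_singleton_iff_inner_right.1 y.2, mul_zero]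
  have := norm_add_sq_eq_norm_sq_add_norm_sq_of_inner_eq_zero _ _ h
  rw [Submodule.coe_norm]
  nlinarith [norm_nonneg (p • (ω : Space d)), norm_nonneg (p • (ω : Space d) + y),
    norm_nonneg (y : Space d)]

/-- By Pythagoras ‖pω + y‖ ≥ ‖y‖, so one bound serves all p. It gives convergence and also
differentiation under the integral. -/
theorem SchwartzMap.exists_integrable_bound_hyperplane (f : 𝓢(Space d, M)) (ω : USphere d) :
    ∃ bound : (Submodule.span ℝ {(ω : Space d)})ᗮ → ℝ, Integrable bound ∧
      ∀ (p : ℝ) (y : (Submodule.span ℝ {(ω : Space d)})ᗮ),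
        ‖f (p • (ω : Space d) + y)‖ ≤ bound y := by
  let N := Module.finrank ℝ (Submodule.span ℝ {(ω : Space d)})ᗮ + 1
  obtain ⟨C, hC, hf⟩ := f.exists_norm_le_inv_one_add_pow N
  refine ⟨fun y => C * ((1 + ‖y‖) ^ N)⁻¹, ?_, fun p y => (hf _).trans ?_⟩
  · have h := integrable_one_add_norm (μ := (volume : Measure (Submodule.span ℝ {(ω : Space d)})ᗮ))
      (r := N) (by simp [N])
    refine (h.congr (ae_of_all _ fun y => ?_)).const_mul C
    simp only [Real.rpow_neg (by positivity : 0 ≤ 1 + ‖y‖), Real.rpow_natCast]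
  · refine mul_le_mul_of_nonneg_left ?_ hC
    gcongr
    exact norm_le_norm_smul_add_of_mem_orthogonal ω p y

theorem SchwartzMap.radonIntegrable (f : 𝓢(Space d, M)) (ω : USphere d) (p : ℝ) :
    RadonIntegrable f ω p := by
  obtain ⟨bound, hb, hf⟩ := f.exists_integrable_bound_hyperplane ω
  exact hb.mono' (by fun_prop : Continuous _).aestronglyMeasurable (ae_of_all _ (hf p))

/-- The Radon transform as a linear functional on Schwartz functions. -/
noncomputable def radonLM (ω : USphere d) (p : ℝ) : 𝓢(Space d, ℝ) →ₗ[ℝ] ℝ where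
  toFun f := radon (f : Space d → ℝ) ω p
  map_add' f g := integral_add (f.radonIntegrable ω p) (g.radonIntegrable ω p)
  map_smul' c _ := integral_const_mul c _

theorem radonLM_apply (ω : USphere d) (p : ℝ) (f : 𝓢(Space d, ℝ)) :
    radonLM ω p f = radon f ω p := rfl

theorem SchwartzMap.hasDerivAt_radon (f : 𝓢(Space d, ℝ)) (ω : USphere d) (p : ℝ) :
    HasDerivAt (fun p => radonLM ω p f) (radonLM ω p (∂_{(ω : Space d)} f)) p := by
  obtain ⟨bound, hb, hf⟩ := (∂_{(ω : Space d)} f).exists_integrable_bound_hyperplane ω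
  refine (hasDerivAt_integral_of_dominated_loc_of_deriv_le (bound := bound)
    (F := fun p (y : (Submodule.span ℝ {(ω : Space d)})ᗮ) => f (p • (ω : Space d) + y))
    (F' := fun p (y : (Submodule.span ℝ {(ω : Space d)})ᗮ) =>
      (∂_{(ω : Space d)} f) (p • (ω : Space d) + y)) Filter.univ_mem
    (Filter.Eventually.of_forall fun q => (f.radonIntegrable ω q).aestronglyMeasurable)
    (f.radonIntegrable ω p) ((∂_{(ω : Space d)} f).radonIntegrable ω p).aestronglyMeasurable
    (ae_of_all _ fun y q _ => hf q y) hb (ae_of_all _ fun y q _ => ?_)).2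
  have h1 : HasDerivAt (fun r : ℝ => r • (ω : Space d) + (y : Space d)) ω q := by
    simpa using ((hasDerivAt_id q).smul_const (ω : Space d)).add_const (y : Space d)
  exact (f.hasFDerivAt _).comp_hasDerivAt q h1

theorem SchwartzMap.contDiff_radon (f : 𝓢(Space d, ℝ)) (ω : USphere d) (n : ℕ) :
    ContDiff ℝ n (fun p => radonLM ω p f) := by
  induction n generalizing f with
  | zero =>
    exact contDiff_zero.2 (Differentiable.continuous (𝕜 := ℝ)
      fun p => (f.hasDerivAt_radon ω p).differentiableAt)
  | succ n ih =>
    push_cast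
    rw [contDiff_succ_iff_deriv]
    refine ⟨fun p => (f.hasDerivAt_radon ω p).differentiableAt, by simp, ?_⟩
    rw [show deriv (fun p => radonLM ω p f) = fun p => radonLM ω p (∂_{(ω : Space d)} f) from
      funext fun p => (f.hasDerivAt_radon ω p).deriv]
    exact ih _

theorem SchwartzMap.iteratedDeriv_two_radon (f : 𝓢(Space d, ℝ)) (ω : USphere d) (p : ℝ) :
    iteratedDeriv 2 (fun p => radonLM ω p f) p =
      radonLM ω p (∂_{(ω : Space d)} (∂_{(ω : Space d)} f)) := by
  rw [iteratedDeriv_succ, iteratedDeriv_one,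
    show deriv (fun p => radonLM ω p f) = fun p => radonLM ω p (∂_{(ω : Space d)} f) from
      funext fun p => (f.hasDerivAt_radon ω p).deriv, (SchwartzMap.hasDerivAt_radon _ ω p).deriv]

theorem SchwartzMap.radon_lineDeriv_of_orthogonal (f : 𝓢(Space d, ℝ)) (ω : USphere d) (p : ℝ)
    {v : Space d} (hv : inner ℝ (ω : Space d) v = 0) : radonLM ω p (∂_{v} f) = 0 := by
  let v' : (Submodule.span ℝ {(ω : Space d)})ᗮ :=
    ⟨v, Submodule.mem_orthogonal_singleton_iff_inner_right.2 hv⟩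
  have hi (g : 𝓢(Space d, ℝ)) : Integrable fun y : (Submodule.span ℝ {(ω : Space d)})ᗮ =>
    g (p • (ω : Space d) + y) := g.radonIntegrable ω p
  have hi' : Integrable fun y : (Submodule.span ℝ {(ω : Space d)})ᗮ =>
    fderiv ℝ f (p • (ω : Space d) + y) v' := hi (∂_{v} f)
  -- Integration by parts on the hyperplane against the constant 1.
  have h := integral_bilinear_hasFDerivAt_right_eq_neg_left_of_integrable
    (μ := (volume : Measure (Submodule.span ℝ {(ω : Space d)})ᗮ))
    (f := fun _ => (1 : ℝ)) (f' := fun _ => 0) (v := v') (B := ContinuousLinearMap.mul ℝ ℝ)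
    (g := fun y => f (p • (ω : Space d) + y))
    (g' := fun y => (fderiv ℝ f (p • (ω : Space d) + y)).comp (Submodule.subtypeL _))
    (by simp) (by simpa using hi') (by simpa using hi f) (fun _ _ => hasFDerivAt_const _ _)
    (fun y _ => (f.hasFDerivAt _).comp y
      ((Submodule.subtypeL _).hasFDerivAt.const_add (p • (ω : Space d))))
  simp only [ContinuousLinearMap.mul_apply', one_mul, zero_apply, zero_mul,
    integral_zero, neg_zero] at h
  exact h

theorem SchwartzMap.radon_lineDeriv (f : 𝓢(Space d, ℝ)) (ω : USphere d) (p : ℝ) (v : Space d) :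
    radonLM ω p (∂_{v} f) = inner ℝ (ω : Space d) v * radonLM ω p (∂_{(ω : Space d)} f) := by
  have h := f.radon_lineDeriv_of_orthogonal ω p
    (v := v - inner ℝ (ω : Space d) v • (ω : Space d)) (by
      rw [inner_sub_right, real_inner_smul_right, ω.inner_self]; ring)
  rw [sub_eq_add_neg, ← neg_smul, lineDerivOp_left_add, lineDerivOp_left_smul,
    map_add, map_smul, smul_eq_mul] at h
  linarith

theorem SchwartzMap.radon_lineDeriv_lineDeriv (f : 𝓢(Space d, ℝ)) (ω : USphere d) (p : ℝ)
    (u v : Space d) :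
    radonLM ω p (∂_{u} (∂_{v} f)) = inner ℝ (ω : Space d) u * inner ℝ (ω : Space d) v *
      radonLM ω p (∂_{(ω : Space d)} (∂_{(ω : Space d)} f)) := by
  -- The transform of ∂_ω∂_v f is read back as the p-derivative of the transform of ∂_v f, so the
  -- first-order rule applies again without commuting derivatives.
  rw [SchwartzMap.radon_lineDeriv, mul_assoc,
    ← (SchwartzMap.hasDerivAt_radon (∂_{v} f) ω p).deriv]
  congr 1
  simp_rw [f.radon_lineDeriv ω _ v]
  exact ((SchwartzMap.hasDerivAt_radon _ ω p).const_mul _).deriv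

theorem SchwartzMap.radon_laplacian (f : 𝓢(Space d, ℝ)) (ω : USphere d) (p : ℝ) :
    radonLM ω p (Δ f) = radonLM ω p (∂_{(ω : Space d)} (∂_{(ω : Space d)} f)) := by
  rw [SchwartzMap.laplacian_eq_sum (EuclideanSpace.basisFun (Fin d) ℝ), map_sum]
  rw [Finset.sum_congr rfl fun i _ => f.radon_lineDeriv_lineDeriv ω p _ _, ← Finset.sum_mul]
  have h : ∑ i, inner ℝ (ω : Space d) (EuclideanSpace.basisFun (Fin d) ℝ i) *
      inner ℝ (ω : Space d) (EuclideanSpace.basisFun (Fin d) ℝ i) = 1 := by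
    refine Eq.trans ?_ ω.inner_self
    rw [← (EuclideanSpace.basisFun (Fin d) ℝ).sum_inner_mul_inner]
    exact Finset.sum_congr rfl fun i _ => congrArg _ (real_inner_comm _ _)
  rw [h, one_mul]

end RadonSchwartz

/-! ### Longitudinal and weighted data expressed through Ψ and Φ. -/

section RadonData

open LineDeriv Laplacian

variable {d : ℕ}

theorem inner_eq_sum_mul (x y : Space d) : inner ℝ x y = ∑ i, x i * y i := by
  simp [PiLp.inner_apply, mul_comm]

theorem IsAdaptedFrame.sum_inner_smul {w : USphere d → Fin (d - 1) → Space d}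
    (hw : IsAdaptedFrame w) (hd : 1 ≤ d) (ω : USphere d) (x : Space d) :
    ∑ k, inner ℝ (w ω k) x • w ω k = x - inner ℝ (ω : Space d) x • (ω : Space d) := by
  obtain ⟨ho, hω⟩ := hw ω
  -- The index `none` stands for ω; the d orthonormal vectors form a basis.
  let v : Option (Fin (d - 1)) → Space d := fun k => k.elim ω (w ω)
  have hv : Orthonormal ℝ v := by
    rw [orthonormal_iff_ite] at ho ⊢
    rintro (_ | i) (_ | j)
    · simp [v]
    · simpa [v] using hω j
    · simpa [v, real_inner_comm] using hω i
    · simpa [v] using ho i j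
  let b := (basisOfOrthonormalOfCardEqFinrank hv (by simp; omega)).toOrthonormalBasis
    (by simpa using hv)
  have hb : ⇑b = v := by simp [b]
  have h := b.sum_repr' x
  rw [Fintype.sum_option, hb] at h
  rw [eq_sub_iff_add_eq, add_comm]
  exact h

theorem longRadon_eq_inner (w : USphere d → Fin (d - 1) → Space d) (k : Fin (d - 1))
    (F : 𝓢(Space d, Space d)) (ω : USphere d) (p : ℝ) :
    longRadon w k F ω p = inner ℝ (w ω k) (vecRadon F ω p) := by
  have h : (fun x => inner ℝ (w ω k) (F x)) = ⇑(∑ i, (w ω k) i • F.coord i) := by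
    ext x
    simp [inner_eq_sum_mul, sum_apply]
  rw [longRadon, h, ← radonLM_apply, map_sum, inner_eq_sum_mul]
  simp only [map_smul, smul_eq_mul]
  rfl

/-- The part of a vector field orthogonal to `ω`, componentwise. -/
noncomputable def SchwartzMap.tangential (F : 𝓢(Space d, Space d)) (ω : USphere d) (j : Fin d) :
    𝓢(Space d, ℝ) :=
  F.coord j - ∑ i, ((ω : Space d) j * (ω : Space d) i) • F.coord i

/-- The sum is the projection of RF to the complement of ω, hence independent of the frame. For
fixed ω it consists of transforms of fixed Schwartz functions, so it can be differentiated in p. -/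
theorem sum_longRadon_smul {w : USphere d → Fin (d - 1) → Space d} (hw : IsAdaptedFrame w)
    (hd : 1 ≤ d) (F : 𝓢(Space d, Space d)) (ω : USphere d) (p : ℝ) :
    ∑ k, longRadon w k F ω p • w ω k =
      WithLp.toLp 2 fun j => radonLM ω p (F.tangential ω j) := by
  simp_rw [longRadon_eq_inner]
  rw [hw.sum_inner_smul hd ω]
  ext j
  simp only [SchwartzMap.tangential, map_sub, map_sum, map_smul, PiLp.sub_apply, PiLp.smul_apply,
    inner_eq_sum_mul, smul_eq_mul, Finset.sum_mul]
  refine congrArg _ (Finset.sum_congr rfl fun i _ => ?_)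
  simp only [vecRadon, radonLM_apply]
  rw [show ⇑(F.coord i) = fun x => F x i from rfl]
  ring

theorem SchwartzMap.lineDerivOp_tangential (F : 𝓢(Space d, Space d)) (ω : USphere d) (j : Fin d)
    (v : Space d) : ∂_{v} (F.tangential ω j) =
      ∂_{v} (F.coord j) - ∑ i, ((ω : Space d) j * (ω : Space d) i) • ∂_{v} (F.coord i) := by
  simp only [SchwartzMap.tangential, sub_eq_add_neg, lineDerivOp_add, lineDerivOp_neg,
    lineDerivOp_sum, lineDerivOp_smul]

/-- Under the transform Δ becomes ∂_p² and ∂_j∂_i becomes ω_jω_i∂_p². -/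
theorem SchwartzMap.radon_lapSol (F : 𝓢(Space d, Space d)) (ω : USphere d) (p : ℝ) (j : Fin d) :
    radonLM ω p (F.lapSol j) =
      radonLM ω p (∂_{(ω : Space d)} (∂_{(ω : Space d)} (F.tangential ω j))) := by
  rw [F.lineDerivOp_tangential, sub_eq_add_neg, lineDerivOp_add, lineDerivOp_neg, lineDerivOp_sum,
    ← sub_eq_add_neg]
  simp only [lineDerivOp_smul, SchwartzMap.lapSol, SchwartzMap.div, lineDerivOp_sum, map_sub,
    map_sum, map_smul, smul_eq_mul, SchwartzMap.radon_laplacian]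
  refine congrArg _ (Finset.sum_congr rfl fun i _ => ?_)
  rw [SchwartzMap.radon_lineDeriv_lineDeriv, EuclideanSpace.inner_single_right,
    EuclideanSpace.inner_single_right]
  simp

theorem hasDerivAt_toLp_radon (f : Fin d → 𝓢(Space d, ℝ)) (ω : USphere d) (p : ℝ) :
    HasDerivAt (fun p => (WithLp.toLp 2 fun j => radonLM ω p (f j) : Space d))
      (WithLp.toLp 2 fun j => radonLM ω p (∂_{(ω : Space d)} (f j))) p := by
  have h : HasDerivAt (fun p j => radonLM ω p (f j))
      (fun j => radonLM ω p (∂_{(ω : Space d)} (f j))) p :=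
    hasDerivAt_pi.2 fun j => (f j).hasDerivAt_radon ω p
  exact (PiLp.hasFDerivAt_toLp 2 _).comp_hasDerivAt p h

theorem iteratedDeriv_two_toLp_radon (f : Fin d → 𝓢(Space d, ℝ)) (ω : USphere d) (p : ℝ) :
    iteratedDeriv 2 (fun p => (WithLp.toLp 2 fun j => radonLM ω p (f j) : Space d)) p =
      WithLp.toLp 2 fun j => radonLM ω p (∂_{(ω : Space d)} (∂_{(ω : Space d)} (f j))) := by
  rw [iteratedDeriv_succ, iteratedDeriv_one,
    funext fun p => (hasDerivAt_toLp_radon f ω p).deriv, (hasDerivAt_toLp_radon _ ω p).deriv]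

theorem contDiff_toLp_radon (f : Fin d → 𝓢(Space d, ℝ)) (ω : USphere d) (n : ℕ) :
    ContDiff ℝ n (fun p => (WithLp.toLp 2 fun j => radonLM ω p (f j) : Space d)) :=
  contDiff_euclidean.2 fun j => (f j).contDiff_radon ω n

theorem vecRadon_lapSolenoidal (hd : 2 ≤ d) {w : USphere d → Fin (d - 1) → Space d}
    (hw : IsAdaptedFrame w) (F : 𝓢(Space d, Space d)) (ω : USphere d) (p : ℝ) :
    vecRadon (lapSolenoidal F) ω p =
      iteratedDeriv 2 (fun q => ∑ j, longRadon w j F ω q • w ω j) p := by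
  simp_rw [sum_longRadon_smul hw (by omega : 1 ≤ d) F ω]
  rw [iteratedDeriv_two_toLp_radon]
  ext j
  simp only [vecRadon]
  rw [← SchwartzMap.radon_lapSol, radonLM_apply]
  congr 1
  ext x
  exact lapSolenoidal_apply hd F x j

/-- The product of a Schwartz function with the linear function `x ↦ ⟪v, x⟫`. -/
noncomputable def SchwartzMap.innerMul (v : Space d) (f : 𝓢(Space d, ℝ)) : 𝓢(Space d, ℝ) :=
  SchwartzMap.smulLeftCLM ℝ (innerSL ℝ v) f

@[simp]
theorem SchwartzMap.innerMul_apply (v : Space d) (f : 𝓢(Space d, ℝ)) (x : Space d) :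
    f.innerMul v x = inner ℝ v x * f x := by
  rw [SchwartzMap.innerMul, SchwartzMap.smulLeftCLM_apply_apply
    (innerSL ℝ v).hasTemperateGrowth]
  simp

theorem SchwartzMap.lineDerivOp_innerMul (v u : Space d) (f : 𝓢(Space d, ℝ)) :
    ∂_{u} (f.innerMul v) = inner ℝ v u • f + (∂_{u} f).innerMul v := by
  ext x
  have h := ((innerSL ℝ v).hasFDerivAt (x := x)).mul (f.hasFDerivAt x)
  have h' : ⇑(f.innerMul v) = (innerSL ℝ v) * f := by
    ext y
    simp
  rw [SchwartzMap.lineDerivOp_apply_eq_fderiv, h', h.fderiv]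
  simp [SchwartzMap.lineDerivOp_apply_eq_fderiv]
  ring

theorem SchwartzMap.laplacian_innerMul (v : Space d) (f : 𝓢(Space d, ℝ)) :
    Δ (f.innerMul v) = (2 : ℝ) • ∂_{v} f + (Δ f).innerMul v := by
  let b := EuclideanSpace.basisFun (Fin d) ℝ
  have h1 : ∂_{v} f = ∑ i, inner ℝ v (b i) • ∂_{b i} f := by
    conv_lhs => rw [← b.sum_repr' v, lineDerivOp_left_sum]
    refine Finset.sum_congr rfl fun i _ => ?_
    rw [lineDerivOp_left_smul, real_inner_comm]
  rw [SchwartzMap.laplacian_eq_sum b, SchwartzMap.laplacian_eq_sum b, h1]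
  simp only [SchwartzMap.lineDerivOp_innerMul, lineDerivOp_add, lineDerivOp_smul,
    Finset.sum_add_distrib, two_smul]
  rw [add_assoc]
  congr 2
  simp only [SchwartzMap.innerMul, map_sum]

/-- The component of a Schwartz vector field in the direction `v`. -/
noncomputable def SchwartzMap.innerConst (v : Space d) (F : 𝓢(Space d, Space d)) : 𝓢(Space d, ℝ) :=
  SchwartzMap.postcompCLM (innerSL ℝ v) F

theorem SchwartzMap.innerConst_apply (v : Space d) (F : 𝓢(Space d, Space d)) (x : Space d) :
    F.innerConst v x = inner ℝ v (F x) := rfl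

theorem SchwartzMap.innerConst_eq_sum (v : Space d) (F : 𝓢(Space d, Space d)) :
    F.innerConst v = ∑ i, v i • F.coord i := by
  ext x
  simp [SchwartzMap.innerConst_apply, inner_eq_sum_mul, sum_apply]

theorem SchwartzMap.innerConst_lapSolField (v : Space d) (F : 𝓢(Space d, Space d)) :
    F.lapSolField.innerConst v = Δ (F.innerConst v) - ∂_{v} F.div := by
  have h1 : ∂_{v} F.div = ∑ i, v i • ∂_{(EuclideanSpace.single i 1 : Space d)} F.div := by
    conv_lhs => rw [← (EuclideanSpace.basisFun (Fin d) ℝ).sum_repr v, lineDerivOp_left_sum]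
    refine Finset.sum_congr rfl fun i _ => ?_
    rw [lineDerivOp_left_smul]
    simp
  have h2 : Δ (F.innerConst v) = ∑ i, v i • Δ (F.coord i) := by
    rw [F.innerConst_eq_sum, ← SchwartzMap.laplacianCLM_eq', map_sum]
    simp only [map_smul, SchwartzMap.laplacianCLM_eq']
  rw [h1, h2, ← Finset.sum_sub_distrib, SchwartzMap.innerConst_eq_sum]
  refine Finset.sum_congr rfl fun i _ => ?_
  rw [← smul_sub]
  congr 1
  ext x
  simp [SchwartzMap.lapSolField, sum_apply, Pi.single_apply, SchwartzMap.lapSol]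

/-- With h = v·F, the product rule gives (v·x)Δh = Δ((v·x)h) - 2∂_v h and (v·x)∂_vΦ = ∂_v((v·x)Φ) -
Φ. All pure v-derivatives vanish under the transform because v is tangent to the hyperplane. -/
theorem SchwartzMap.radon_innerMul_innerConst_lapSolField (F : 𝓢(Space d, Space d))
    (ω : USphere d) (p : ℝ) {v : Space d} (hv : ‖v‖ = 1) (hωv : inner ℝ (ω : Space d) v = 0) :
    radonLM ω p ((F.lapSolField.innerConst v).innerMul v) =
      radonLM ω p (∂_{(ω : Space d)} (∂_{(ω : Space d)} ((F.innerConst v).innerMul v))) +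
        radonLM ω p F.div := by
  have hvv : inner ℝ v v = (1 : ℝ) := by rw [real_inner_self_eq_norm_sq, hv, one_pow]
  have h1 : (F.lapSolField.innerConst v).innerMul v = (Δ (F.innerConst v)).innerMul v -
      (∂_{v} F.div).innerMul v := by
    rw [F.innerConst_lapSolField]
    exact map_sub _ _ _
  have h2 := congrArg (radonLM ω p) ((F.innerConst v).laplacian_innerMul v)
  have h3 := congrArg (radonLM ω p) (F.div.lineDerivOp_innerMul v v)
  rw [SchwartzMap.radon_laplacian, map_add, map_smul,
    SchwartzMap.radon_lineDeriv_of_orthogonal _ ω p hωv, smul_zero, zero_add] at h2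
  rw [SchwartzMap.radon_lineDeriv_of_orthogonal _ ω p hωv, hvv, one_smul, map_add] at h3
  rw [h1, map_sub, ← h2]
  linarith

theorem weightedLongRadon_eq (w : USphere d → Fin (d - 1) → Space d) (k : Fin (d - 1))
    (F : 𝓢(Space d, Space d)) (ω : USphere d) :
    weightedLongRadon w k F ω = fun p => radonLM ω p ((F.innerConst (w ω k)).innerMul (w ω k)) := by
  ext p
  rw [radonLM_apply, weightedLongRadon]
  congr 1
  ext x
  rw [SchwartzMap.innerMul_apply, SchwartzMap.innerConst_apply]

theorem radon_weighted_lapSolenoidal_sub (hd : 2 ≤ d) {w : USphere d → Fin (d - 1) → Space d}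
    (hw : IsAdaptedFrame w) (k : Fin (d - 1)) (F : 𝓢(Space d, Space d)) (ω : USphere d) (p : ℝ) :
    radon (fun x => inner ℝ x (w ω k) * inner ℝ (w ω k) (lapSolenoidal F x)) ω p -
      iteratedDeriv 2 (weightedLongRadon w k F ω) p = radon F.div ω p := by
  have h : (fun x => inner ℝ x (w ω k) * inner ℝ (w ω k) (lapSolenoidal F x)) =
      ⇑((F.lapSolField.innerConst (w ω k)).innerMul (w ω k)) := by
    ext x
    rw [SchwartzMap.innerMul_apply, SchwartzMap.innerConst_apply, lapSolenoidal_eq_lapSolField hd,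
      real_inner_comm]
  rw [h, weightedLongRadon_eq, SchwartzMap.iteratedDeriv_two_radon, ← radonLM_apply,
    F.radon_innerMul_innerConst_lapSolField ω p ((hw ω).1.1 k) ((hw ω).2 k), add_sub_cancel_left,
    radonLM_apply]

end RadonData

/-! ### Fourier transforms in the sense of tempered distributions. -/

section FourierTools

open Real

variable {V : Type*} [NormedAddCommGroup V] [InnerProductSpace ℝ V] [FiniteDimensional ℝ V]
  [MeasurableSpace V] [BorelSpace V]

theorem MeasureTheory.Integrable.mul_schwartz {u : V → ℂ} (hu : Integrable u) (φ : 𝓢(V, ℂ)) :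
    Integrable (fun x => u x * φ x) :=
  hu.mul_bdd (c := SchwartzMap.seminorm ℝ 0 0 φ) φ.continuous.aestronglyMeasurable
    (ae_of_all _ fun x => φ.norm_le_seminorm ℝ x)

theorem integrable_fourier_mul_schwartz {u : V → ℂ} (hu : Integrable u) (φ : 𝓢(V, ℂ)) :
    Integrable (fun x => 𝓕 u x * φ x) := by
  refine φ.integrable.bdd_mul (c := ∫ x, ‖u x‖) ?_ (ae_of_all _ fun x => ?_)
  · exact (VectorFourier.fourierIntegral_continuous continuous_fourierChar
      continuous_inner hu).aestronglyMeasurable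
  · exact VectorFourier.norm_fourierIntegral_le_integral_norm _ _ _ _ _

theorem isFourierTransform_fourier {u : V → ℂ} (hu : Integrable u) :
    IsFourierTransform u (𝓕 u) := by
  intro φ
  refine ⟨hu.mul_schwartz φ, integrable_fourier_mul_schwartz hu φ, ?_⟩
  have h := VectorFourier.integral_fourierIntegral_smul_eq_flip (L := innerₗ V)
    continuous_fourierChar continuous_inner hu (φ.integrable (μ := volume))
  simp only [flip_innerₗ, smul_eq_mul] at h
  exact h.symm

/-- The inverse transform of u need not be integrable, so its Fourier transform is only weak: the
inverse transform is moved onto the test function, where Fourier inversion holds. -/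
theorem isFourierTransform_fourierInv {u : V → ℂ} (hu : Integrable u) :
    IsFourierTransform (𝓕⁻ u) u := by
  intro φ
  refine ⟨?_, hu.mul_schwartz φ, ?_⟩
  · rw [fourierInv_eq_fourier_comp_neg]
    exact integrable_fourier_mul_schwartz hu.comp_neg φ
  · have h := VectorFourier.integral_fourierIntegral_smul_eq_flip (L := -innerₗ V)
      continuous_fourierChar continuous_inner.neg hu ((𝓕 φ).integrable (μ := volume))
    have h2 : (-innerₗ V).flip = -innerₗ V := by
      ext x y
      simp [real_inner_comm]
    rw [h2] at h
    refine h.trans ?_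
    simp only [smul_eq_mul]
    refine integral_congr_ae (ae_of_all _ fun x => congrArg _ ?_)
    change 𝓕⁻ ((𝓕 φ : 𝓢(V, ℂ)) : V → ℂ) x = φ x
    rw [← SchwartzMap.fourierInv_coe, FourierTransform.fourierInv_fourier_eq]

end FourierTools

/-! ### The Fourier slice theorem. -/

section FourierSlice

open Real

variable {d : ℕ}

theorem measurePreserving_hyperplane_foliation (ω : USphere d) :
    MeasurePreserving (fun q : ℝ × (Submodule.span ℝ {(ω : Space d)})ᗮ =>
      q.1 • (ω : Space d) + (q.2 : Space d)) := by
  have hω : ‖(ω : Space d)‖ = 1 := by simp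
  have h1 : MeasurePreserving (Prod.map (LinearIsometryEquiv.toSpanUnitSingleton (𝕜 := ℝ) _ hω)
      (id : (Submodule.span ℝ {(ω : Space d)})ᗮ → _)) :=
    (LinearIsometryEquiv.toSpanUnitSingleton (𝕜 := ℝ) _ hω).measurePreserving.prod
      (MeasurePreserving.id volume)
  have h2 := WithLp.volume_preserving_toLp (Submodule.span ℝ {(ω : Space d)})
    (Submodule.span ℝ {(ω : Space d)})ᗮ
  have h3 := (Submodule.span ℝ {(ω : Space d)}).orthogonalDecomposition.symm.measurePreserving
  have h := (h3.comp h2).comp h1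
  convert h using 1
  ext q
  simp

variable {f : Space d → ℂ}

theorem integrable_hyperplane_foliation (hf : Integrable f) (ω : USphere d) :
    Integrable (fun q : ℝ × (Submodule.span ℝ {(ω : Space d)})ᗮ =>
      f (q.1 • (ω : Space d) + (q.2 : Space d))) (volume.prod volume) :=
  (measurePreserving_hyperplane_foliation ω).integrable_comp_of_integrable hf

theorem integral_hyperplane_foliation (hf : Integrable f) (ω : USphere d) :
    ∫ x, f x = ∫ p : ℝ, ∫ y : (Submodule.span ℝ {(ω : Space d)})ᗮ,
      f (p • (ω : Space d) + (y : Space d)) := by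
  rw [← integral_prod _ (integrable_hyperplane_foliation hf ω)]
  have h := measurePreserving_hyperplane_foliation ω
  conv_lhs => rw [← h.map_eq]
  refine integral_map h.aemeasurable ?_
  rw [h.map_eq]
  exact hf.aestronglyMeasurable

/-- At the frequency ηω the character is constant on hyperplanes orthogonal to ω, so Fubini over
these hyperplanes suffices. -/
theorem fourier_slice (hf : Integrable f) (ω : USphere d) (η : ℝ) :
    𝓕 (fun p : ℝ => ∫ y : (Submodule.span ℝ {(ω : Space d)})ᗮ,
      f (p • (ω : Space d) + (y : Space d))) η = 𝓕 f (η • (ω : Space d)) := by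
  rw [fourier_eq, fourier_eq,
    integral_hyperplane_foliation ((fourierIntegral_convergent_iff _).2 hf) ω]
  congr 1
  ext p
  rw [Circle.smul_def, ← integral_smul]
  congr 1
  ext y
  have hy : inner ℝ (y : Space d) (ω : Space d) = 0 := by
    rw [real_inner_comm]
    exact Submodule.mem_orthogonal_singleton_iff_inner_right.1 y.2
  rw [inner_add_left, real_inner_smul_left, real_inner_smul_right, real_inner_smul_right,
    USphere.inner_self, hy, Circle.smul_def]
  congr 4
  simp [mul_comm]

theorem SchwartzMap.integrable_radon (f : 𝓢(Space d, ℝ)) (ω : USphere d) :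
    Integrable (fun p => (radon f ω p : ℂ)) := by
  have h := (integrable_hyperplane_foliation f.integrable.ofReal ω).integral_prod_left
  refine h.congr (ae_of_all _ fun p => ?_)
  exact integral_ofReal

theorem SchwartzMap.fourier_radon (f : 𝓢(Space d, ℝ)) (ω : USphere d) (η : ℝ) :
    𝓕 (fun p => (radon f ω p : ℂ)) η = 𝓕 (fun x => (f x : ℂ)) (η • (ω : Space d)) := by
  have hf : Integrable fun x => (f x : ℂ) := f.integrable.ofReal
  rw [← fourier_slice hf]
  exact congrArg (fun g : ℝ → ℂ => 𝓕 g η) (funext fun p => integral_ofReal.symm)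

end FourierSlice

/-! ### Filtered backprojection. -/

section RadonInversion

open Real Set

variable {d : ℕ}

theorem two_pi_mul_norm_rpow {V : Type*} [NormedAddCommGroup V] (β : ℝ) (x : V) :
    (2 * π * ‖x‖) ^ β = (2 * π) ^ β * ‖x‖ ^ β :=
  mul_rpow (by positivity) (norm_nonneg x)

theorem SchwartzMap.integrable_two_pi_norm_rpow_mul {V : Type*} [NormedAddCommGroup V]
    [InnerProductSpace ℝ V] [FiniteDimensional ℝ V] [MeasurableSpace V] [BorelSpace V]
    [Nontrivial V] (φ : 𝓢(V, ℂ)) {β : ℝ} (hβ : -(Module.finrank ℝ V : ℝ) < β) :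
    Integrable (fun x : V => (((2 * π * ‖x‖) ^ β : ℝ) : ℂ) * φ x) := by
  refine ((φ.integrable_norm_rpow_smul hβ).const_mul (((2 * π) ^ β : ℝ) : ℂ)).congr
    (ae_of_all _ fun x => ?_)
  simp only [two_pi_mul_norm_rpow, Complex.real_smul]
  push_cast
  ring

/-- The restriction of a Schwartz function to the line spanned by a unit vector. -/
noncomputable def SchwartzMap.restrictLine (φ : 𝓢(Space d, ℂ)) (ω : USphere d) : 𝓢(ℝ, ℂ) :=
  SchwartzMap.compCLMOfAntilipschitz ℝ (g := fun r : ℝ => r • (ω : Space d)) (K := 1)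
    (ContinuousLinearMap.toSpanSingleton ℝ (ω : Space d)).hasTemperateGrowth
    (AntilipschitzWith.of_le_mul_dist fun x y => by
      rw [dist_eq_norm, dist_eq_norm, ← sub_smul, norm_smul]; simp) φ

/-- Full lines through the origin, indexed by the whole sphere, cover space twice; hence the factor
2. -/
theorem integral_sphere_add_neg (hd : 2 ≤ d) {g : Space d → ℂ} (hg : Integrable g) :
    Integrable (fun ω : USphere d =>
      (∫ r in Ioi (0 : ℝ), r ^ (d - 1) • g (r • (ω : Space d))) +
        ∫ r in Ioi (0 : ℝ), r ^ (d - 1) • g (-(r • (ω : Space d))))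
      (volume : Measure (Space d)).toSphere ∧
    ∫ ω : USphere d, ((∫ r in Ioi (0 : ℝ), r ^ (d - 1) • g (r • (ω : Space d))) +
        ∫ r in Ioi (0 : ℝ), r ^ (d - 1) • g (-(r • (ω : Space d))))
      ∂(volume : Measure (Space d)).toSphere = 2 * ∫ x, g x := by
  have : Nonempty (Fin d) := ⟨⟨0, by omega⟩⟩
  have hi : ∀ {g : Space d → ℂ}, Integrable g → Integrable (fun ω : USphere d =>
      ∫ r in Ioi (0 : ℝ), r ^ (d - 1) • g (r • (ω : Space d)))
      (volume : Measure (Space d)).toSphere := fun {g} hg => by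
    refine (integrable_polar hg).integral_prod_left.congr (ae_of_all _ fun ω => ?_)
    simp only
    rw [integral_volumeIoiPow _ (fun r : ℝ => g (r • (ω : Space d))), finrank_euclideanSpace,
      Fintype.card_fin]
  have hp : ∀ {g : Space d → ℂ}, Integrable g → ∫ ω : USphere d,
      (∫ r in Ioi (0 : ℝ), r ^ (d - 1) • g (r • (ω : Space d)))
      ∂(volume : Measure (Space d)).toSphere = ∫ x, g x := fun {g} hg => by
    rw [integral_polar hg, finrank_euclideanSpace, Fintype.card_fin]
  refine ⟨(hi hg).add (hi hg.comp_neg), ?_⟩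
  rw [integral_add (hi hg) (hi hg.comp_neg), hp hg, hp hg.comp_neg, integral_neg_eq_self g, two_mul]

theorem integral_real_eq_add_neg {g : ℝ → ℂ} (hg : Integrable g) :
    ∫ r, g r = (∫ r in Ioi (0 : ℝ), g r) + ∫ r in Ioi (0 : ℝ), g (-r) := by
  rw [integral_comp_neg_Ioi, neg_zero, add_comm,
    intervalIntegral.integral_Iic_add_Ioi hg.integrableOn hg.integrableOn]

/-- The frequency line splits into two rays. On each, |2πη|^(d-1-α) factors as (2π)^(d-1) times the
polar Jacobian r^(d-1) times (2πr)^(-α), the multiplier of I^α on space. -/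
theorem inner_filtered_eq (hd : 2 ≤ d) (φ : 𝓢(Space d, ℂ)) {α : ℝ} (hα : α < d) (ω : USphere d)
    (x : Space d) :
    𝓕⁻ (fun η : ℝ => (((2 * π * ‖η‖) ^ (-(α - d + 1)) : ℝ) : ℂ) * φ (η • (ω : Space d)))
        (inner ℝ (ω : Space d) x) =
      (((2 * π) ^ (d - 1 : ℝ) : ℝ) : ℂ) *
      ((∫ r in Ioi (0 : ℝ), r ^ (d - 1) • (𝐞 (inner ℝ (r • (ω : Space d)) x) •
        ((((2 * π * ‖r • (ω : Space d)‖) ^ (-α) : ℝ) : ℂ) * φ (r • (ω : Space d))))) +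
      ∫ r in Ioi (0 : ℝ), r ^ (d - 1) • (𝐞 (inner ℝ (-(r • (ω : Space d))) x) •
        ((((2 * π * ‖-(r • (ω : Space d))‖) ^ (-α) : ℝ) : ℂ) * φ (-(r • (ω : Space d)))))) := by
  have hω : ‖(ω : Space d)‖ = 1 := by simp
  have hint := (φ.restrictLine ω).integrable_two_pi_norm_rpow_mul (β := -(α - d + 1)) (by
    rw [Module.finrank_self]; push_cast; linarith)
  have hint' : Integrable fun η : ℝ => 𝐞 (inner ℝ η (inner ℝ (ω : Space d) x)) •
      ((((2 * π * ‖η‖) ^ (-(α - d + 1)) : ℝ) : ℂ) * φ (η • (ω : Space d))) := by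
    have := (fourierIntegral_convergent_iff (-(inner ℝ (ω : Space d) x))).2 hint
    simpa only [inner_neg_right, neg_neg] using! this
  have hpow : ∀ r : ℝ, 0 < r → (2 * π * r) ^ (-(α - d + 1)) =
      (2 * π) ^ (d - 1 : ℝ) * (r ^ (d - 1) * (2 * π * r) ^ (-α)) := fun r hr => by
    rw [show -(α - d + 1) = (d - 1) + -α by ring, rpow_add (by positivity),
      mul_rpow (z := (d - 1 : ℝ)) (by positivity) hr.le, ← rpow_natCast r (d - 1),
      Nat.cast_sub (by omega : 1 ≤ d), Nat.cast_one, mul_assoc]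
  rw [fourierInv_eq, integral_real_eq_add_neg hint', mul_add, ← integral_const_mul,
    ← integral_const_mul]
  congr 1
  · refine setIntegral_congr_fun measurableSet_Ioi fun r (hr : 0 < r) => ?_
    simp only [norm_smul, hω, mul_one, Real.norm_of_nonneg hr.le, hpow r hr, real_inner_smul_left,
      Circle.smul_def, Complex.real_smul, smul_eq_mul, RCLike.inner_apply, conj_trivial]
    push_cast
    rw [mul_comm (inner ℝ (ω : Space d) x) r]
    ring
  · refine setIntegral_congr_fun measurableSet_Ioi fun r (hr : 0 < r) => ?_
    simp only [norm_neg, norm_smul, hω, mul_one, Real.norm_of_nonneg hr.le, hpow r hr, neg_smul,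
      inner_neg_left, real_inner_smul_left,
      Circle.smul_def, Complex.real_smul, smul_eq_mul, RCLike.inner_apply, conj_trivial]
    push_cast
    rw [mul_neg, mul_comm (inner ℝ (ω : Space d) x) r]
    ring

/-- Backprojecting the filtered data gives 2(2π)^(d-1) I^α f, and the outer filter removes I^α. The
bound α < d makes both |η|^(d-1-α) on the line and |ξ|^(-α) on space integrable at the origin. -/
theorem SchwartzMap.hasRadonInverse (hd : 2 ≤ d) (f : 𝓢(Space d, ℝ)) {α : ℝ} (hα : α < d) :
    HasRadonInverse α (radon f) f := by
  have : Nonempty (Fin d) := ⟨⟨0, by omega⟩⟩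
  let fc : 𝓢(Space d, ℂ) := SchwartzMap.postcompCLM Complex.ofRealCLM f
  let φ : 𝓢(Space d, ℂ) := 𝓕 fc
  let U : Space d → ℂ := fun ξ => (((2 * π * ‖ξ‖) ^ (-α) : ℝ) : ℂ) * φ ξ
  have hU : Integrable U := φ.integrable_two_pi_norm_rpow_mul (by simpa using hα)
  let c : ℂ := (((2 * π) ^ (d - 1 : ℝ) : ℝ) : ℂ) * 2
  have hUe : ∀ x : Space d, Integrable fun ξ => 𝐞 (inner ℝ ξ x) • U ξ := fun x => by
    have := (fourierIntegral_convergent_iff (-x)).2 hU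
    simpa only [inner_neg_right, neg_neg] using this
  have hback : ∀ x : Space d, ∫ ω : USphere d,
      𝓕⁻ (fun η : ℝ => (((2 * π * ‖η‖) ^ (-(α - d + 1)) : ℝ) : ℂ) * φ (η • (ω : Space d)))
        (inner ℝ (ω : Space d) x) ∂(volume : Measure (Space d)).toSphere =
      𝓕⁻ (fun ξ => c * U ξ) x := fun x => by
    simp_rw [inner_filtered_eq hd φ hα _ x]
    rw [integral_const_mul, (integral_sphere_add_neg hd (hUe x)).2, ← mul_assoc, fourierInv_eq,
      ← integral_const_mul]
    refine integral_congr_ae (ae_of_all _ fun ξ => ?_)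
    simp only [Circle.smul_def, smul_eq_mul]
    ring
  refine ⟨fun ω => 𝓕⁻ (fun η : ℝ => (((2 * π * ‖η‖) ^ (-(α - d + 1)) : ℝ) : ℂ) *
    φ (η • (ω : Space d))), fun x => c * fc x, fun ω => ?_, fun x => ?_, ?_, fun x => ?_⟩
  · refine ⟨fun η => φ (η • (ω : Space d)), ?_, ?_, fun _ => rfl⟩
    · convert isFourierTransform_fourier (f.integrable_radon ω) using 1
      ext η
      exact (f.fourier_radon ω η).symm
    · exact (φ.restrictLine ω).integrable_two_pi_norm_rpow_mul (by
        rw [Module.finrank_self]; push_cast; linarith)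
  · simp_rw [inner_filtered_eq hd φ hα _ x]
    exact (integral_sphere_add_neg hd (hUe x)).1.const_mul _
  -- Only almost everywhere: at ξ = 0 the two powers need not multiply to 1.
  · have hae : (fun ξ : Space d => (((2 * π * ‖ξ‖) ^ (- -α) : ℝ) : ℂ) * (c * U ξ)) =ᵐ[volume]
        fun ξ => c * φ ξ := by
      have h0 : ∀ᵐ ξ : Space d, ξ ≠ 0 := by simp [ae_iff]
      filter_upwards [h0] with ξ hξ
      have hpos : 0 < 2 * π * ‖ξ‖ := by have := norm_pos_iff.2 hξ; positivity
      have h1 : (((2 * π * ‖ξ‖) ^ (- -α) : ℝ) : ℂ) * (((2 * π * ‖ξ‖) ^ (-α) : ℝ) : ℂ) = 1 := by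
        rw [← Complex.ofReal_mul, ← rpow_add hpos]
        simp
      simp only [U]
      linear_combination c * φ ξ * h1
    refine ⟨fun ξ => c * U ξ, ?_, (φ.integrable.const_mul c).congr hae.symm, fun x => ?_⟩
    · convert isFourierTransform_fourierInv (hU.const_mul c) using 1
      ext x
      exact hback x
    · rw [fourierInv_eq, integral_congr_ae (hae.mono fun ξ hξ => congrArg _ hξ)]
      have h2 : 𝓕⁻ (φ : Space d → ℂ) x = fc x := by
        rw [← SchwartzMap.fourierInv_coe, FourierTransform.fourierInv_fourier_eq]
      beta_reduce
      rw [← h2, fourierInv_eq, ← integral_const_mul]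
      refine integral_congr_ae (ae_of_all _ fun ξ => ?_)
      simp only [Circle.smul_def, smul_eq_mul]
      ring
  · have h1 : (((2 * π) ^ (1 - d : ℝ) : ℝ) : ℂ) * (((2 * π) ^ (d - 1 : ℝ) : ℝ) : ℂ) = 1 := by
      rw [← Complex.ofReal_mul, ← rpow_add (by positivity)]
      simp
    have h2 : fc x = (f x : ℂ) := rfl
    simp only [c, h2]
    linear_combination -(f x : ℂ) * h1

end RadonInversion

/-! ### Assembly of the reconstruction theorem. -/

theorem theorem3 (d : ℕ) (hd : 2 ≤ d) (F : 𝓢(Space d, Space d))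
    (w : USphere d → Fin (d - 1) → Space d) (hw : IsAdaptedFrame w) :
    -- the potential is defined and smooth, so that `Ψ` is defined
    (ConvolutionExists (divergence F) (fundSol d) (ContinuousLinearMap.lsmul ℝ ℝ) volume ∧
      ContDiff ℝ (⊤ : ℕ∞) (potential F)) ∧
    -- all the Radon transforms below are convergent integrals
    (∀ (ω : USphere d) (p : ℝ),
      RadonIntegrable (lapSolenoidal F) ω p ∧
      RadonIntegrable F ω p ∧
      RadonIntegrable (fun x => inner ℝ (w ω ⟨0, by omega⟩) x *
        inner ℝ (w ω ⟨0, by omega⟩) (F x)) ω p ∧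
      RadonIntegrable (fun x => inner ℝ (w ω ⟨0, by omega⟩) x *
        inner ℝ (w ω ⟨0, by omega⟩) (lapSolenoidal F x)) ω p) ∧
    -- the componentwise Radon transform of `Ψ`
    (∀ ω : USphere d,
      ContDiff ℝ 2 (fun p => ∑ j, longRadon w j F ω p • w ω j) ∧
      ∀ p : ℝ, vecRadon (lapSolenoidal F) ω p =
        iteratedDeriv 2 (fun q => ∑ j, longRadon w j F ω q • w ω j) p) ∧
    -- reconstruction of `Ψ`
    (∀ α : ℝ, α < d → ∀ j : Fin d,
      HasRadonInverse α (fun ω p => vecRadon (lapSolenoidal F) ω p j)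
        (fun x => lapSolenoidal F x j)) ∧
    -- reconstruction of `Φ`
    (∀ ω : USphere d, ContDiff ℝ 2 (weightedLongRadon w ⟨0, by omega⟩ F ω)) ∧
    (∀ α : ℝ, α < d →
      HasRadonInverse α
        (fun ω p =>
          radon (fun x => inner ℝ x (w ω ⟨0, by omega⟩) *
            inner ℝ (w ω ⟨0, by omega⟩) (lapSolenoidal F x)) ω p -
          iteratedDeriv 2 (weightedLongRadon w ⟨0, by omega⟩ F ω) p)
        (divergence F)) ∧
    -- reconstruction of `F`
    ConvolutionExists (divergence F) (gradient (fundSol d))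
      (ContinuousLinearMap.lsmul ℝ ℝ) volume ∧
    (∀ j : Fin d, ConvolutionExists (fun y => lapSolenoidal F y j) (fundSol d)
      (ContinuousLinearMap.lsmul ℝ ℝ) volume) ∧
    ∀ x : Space d, F x =
      (divergence F ⋆[ContinuousLinearMap.lsmul ℝ ℝ, volume] gradient (fundSol d)) x +
      ∑ j : Fin d, ((fun y => lapSolenoidal F y j)
        ⋆[ContinuousLinearMap.lsmul ℝ ℝ, volume] fundSol d) x •
          (EuclideanSpace.single j 1 : Space d) := by
  have hG := integrableUpToGrowth_fundSol hd
  have hcoord : ∀ j, (fun y => lapSolenoidal F y j) = F.lapSol j := fun j =>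
    funext fun y => lapSolenoidal_apply hd F y j
  have hweight : ∀ (v : Space d) (H : 𝓢(Space d, Space d)),
      (fun x => inner ℝ v x * inner ℝ v (H x)) = (H.innerConst v).innerMul v := fun v H => by
    ext x
    rw [SchwartzMap.innerMul_apply, SchwartzMap.innerConst_apply]
  refine ⟨⟨?_, ?_⟩, fun ω p => ⟨?_, F.radonIntegrable ω p, ?_, ?_⟩, fun ω => ⟨?_, fun p =>
    vecRadon_lapSolenoidal hd hw F ω p⟩, fun α hα j => ?_, fun ω => ?_, fun α hα => ?_, ?_,
    fun j => ?_, reconstruct_from_divergence_and_lapSolenoidal hd F⟩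
  · rw [divergence_eq_div]
    exact hG.convolutionExists F.div
  · rw [potential_eq_integral]
    exact hG.contDiff_integral F.div ⊤
  · rw [lapSolenoidal_eq_lapSolField hd]
    exact F.lapSolField.radonIntegrable ω p
  · rw [hweight]
    exact SchwartzMap.radonIntegrable _ ω p
  · rw [lapSolenoidal_eq_lapSolField hd, hweight]
    exact SchwartzMap.radonIntegrable _ ω p
  · simp_rw [sum_longRadon_smul hw (by omega : 1 ≤ d) F ω]
    exact contDiff_toLp_radon _ ω 2
  · have h := (F.lapSol j).hasRadonInverse hd hα
    rw [← hcoord] at h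
    exact h
  · rw [weightedLongRadon_eq]
    exact SchwartzMap.contDiff_radon _ ω 2
  -- The frame-dependent data collapse to the Radon transform of Φ, so no regularity of the frame in
  -- ω is needed.
  · simp_rw [radon_weighted_lapSolenoidal_sub hd hw, divergence_eq_div]
    exact F.div.hasRadonInverse hd hα
  · rw [divergence_eq_div]
    exact (integrableUpToGrowth_gradient_fundSol hd).convolutionExists F.div
  · rw [hcoord]
    exact hG.convolutionExists (F.lapSol j)
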